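/- Let $\Bbbk$ be a field of characteristic $0$. For a group $G$, let $\Gamma_1G=G$, $\Gamma_{n+1}G=[\Gamma_nG,G]$ be its lower central series, and let $G^{(0)}=G$, $G^{(i+1)}=[G^{(i)},G^{(i)}]$ be its derived series. Let $\operatorname{gr}(G;\Bbbk)=\bigoplus_{n\ge 1}(\Gamma_nG/\Gamma_{n+1}G)\otimes_{\mathbb Z}\Bbbk$ be the associated graded Lie algebra, with bracket induced by the group commutator, and let $\widehat{\operatorname{gr}}(G;\Bbbk)$ be its degree completion, filtered by degree. The $i$-th Chen Lie algebra of $G$ is $\operatorname{gr}(G/G^{(i)};\Bbbk)$, and the Chen ranks of $G$ are $\theta_n(G)=\dim_\Bbbk \operatorname{gr}_n(G/G'';\Bbbk)$. The Malcev Lie algebra $\mathfrak m(G;\Bbbk)$ is the Lie algebra of primitive elements of the completion $\widehat{\Bbbk G}=\varprojlim_n \Bbbk G/I^n$ of the group algebra at its augmentation ideal $I$, with the induced filtration. A finitely generated group $G$ is *filtered-formal* over $\Bbbk$ if there is an isomorphism of filtered Lie algebras $\mathfrak m(G;\Bbbk)\cong\widehat{\operatorname{gr}}(G;\Bbbk)$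 inducing the identity on associated graded Lie algebras, where $\operatorname{gr}_n(G;\Bbbk)$ is identified with the $n$-th graded piece of $\mathfrak m(G;\Bbbk)$ by sending $[g]\otimes 1$, for $g\in\Gamma_nG$, to the class of $\log g$ (equivalently, of any $x\in\mathfrak m(G;\Bbbk)$ with $x\equiv g-1$ modulo the $(n+1)$-st term of the filtration). **Theorem.** Let $G_1$ and $G_2$ be finitely generated groups which are filtered-formal over $\Bbbk$. 1. For every morphism of graded Lie algebras $\alpha\colon \operatorname{gr}(G_1;\Bbbk)\to\operatorname{gr}(G_2;\Bbbk)$ and every $i\ge 1$, there is a unique morphism of graded Lie algebras $\alpha_i\colon \operatorname{gr}(G_1/G_1^{(i)};\Bbbk)\to\operatorname{gr}(G_2/G_2^{(i)};\Bbbk)$ induced by $\alpha$, that is, such that $\alpha_i\circ\operatorname{gr}(p_{1,i})=\operatorname{gr}(p_{2,i})\circ\alpha$, where $p_{j,i}\colon G_j\to G_j/G_j^{(i)}$ is the projection. 2. Consequently, if $\operatorname{gr}(G_1;\Bbbk)\cong\operatorname{gr}(G_2;\Bbbk)$ as graded Lie algebras, then $\operatorname{gr}(G_1/G_1^{(i)};\Bbbk)\cong\operatorname{gr}(G_2/G_2^{(i)};\Bbbk)$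 as graded Lie algebras for all $i\ge 1$. 3. In particular, if $\theta_n(G_1)\neq\theta_n(G_2)$ for some $n\ge 1$, then $\operatorname{gr}(G_1;\Bbbk)\not\cong\operatorname{gr}(G_2;\Bbbk)$ as graded Lie algebras. -/

import Mathlib

open scoped TensorProduct DirectSum

noncomputable section

/-- A graded Lie algebra over `k`, given by its homogeneous pieces `L n` and the components
`L i × L j → L (i + j)` of the bracket. -/
class GradedLie (k : Type*) [CommRing k] (L : ℕ → Type*)
    [∀ n, AddCommGroup (L n)] [∀ n, Module k (L n)] where
  br : ∀ i j, L i →ₗ[k] L j →ₗ[k] L (i + j)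
  br_self : ∀ i (x : L i), br i i x x = 0
  br_skew : ∀ i j (x : L i) (y : L j),
    DirectSum.lof k ℕ L (i + j) (br i j x y) + DirectSum.lof k ℕ L (j + i) (br j i y x) = 0
  br_leibniz : ∀ i j l (x : L i) (y : L j) (z : L l),
    DirectSum.lof k ℕ L (i + (j + l)) (br i (j + l) x (br j l y z)) =
      DirectSum.lof k ℕ L (i + j + l) (br (i + j) l (br i j x y) z) +
        DirectSum.lof k ℕ L (j + (i + l)) (br j (i + l) y (br i l x z))

namespace GradedLie

section Modules

/-- The direct sum `⨁ₙ Lₙ`, as the underlying space of the graded Lie algebra. -/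
def DSum (_k : Type*) (L : ℕ → Type*) [∀ n, AddCommGroup (L n)] : Type _ := ⨁ n, L n

/-- The degree completion `∏ₙ Lₙ`. -/
def Completion (_k : Type*) (L : ℕ → Type*) [∀ n, AddCommGroup (L n)] : Type _ := ∀ n, L n

variable (k : Type*) [CommRing k] (L : ℕ → Type*)
    [∀ n, AddCommGroup (L n)] [∀ n, Module k (L n)]

instance : AddCommGroup (DSum k L) := inferInstanceAs (AddCommGroup (⨁ n, L n))
instance : Module k (DSum k L) := inferInstanceAs (Module k (⨁ n, L n))
instance : AddCommGroup (Completion k L) := inferInstanceAs (AddCommGroup (∀ n, L n))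
instance : Module k (Completion k L) := inferInstanceAs (Module k (∀ n, L n))

/-- The inclusion of the degree `n` piece. -/
def DSum.of (n : ℕ) : L n →ₗ[k] DSum k L := DirectSum.lof k ℕ L n

/-- The degree `n` component. -/
def DSum.comp (n : ℕ) : DSum k L →ₗ[k] L n := DirectSum.component k ℕ L n

/-- The degree `n` component. -/
def Completion.comp (n : ℕ) : Completion k L →ₗ[k] L n := LinearMap.proj (φ := L) n

/-- The sum of the components of degree at most `n`. -/
def Completion.trunc (n : ℕ) : Completion k L →ₗ[k] DSum k L :=
  ∑ i ∈ Finset.range (n + 1), DSum.of k L i ∘ₗ Completion.comp k L i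

/-- The degree filtration: `x` lies in its `n`-th term when its components of degree `< n`
vanish. -/
def Completion.filtration (n : ℕ) : Submodule k (Completion k L) where
  carrier := {x | ∀ i < n, Completion.comp k L i x = 0}
  add_mem' hx hy i hi := by rw [map_add, hx i hi, hy i hi, add_zero]
  zero_mem' i _ := map_zero _
  smul_mem' c x hx i hi := by rw [map_smul, hx i hi, smul_zero]

variable {k L}

@[elab_as_elim]
theorem DSum.induction {p : DSum k L → Prop} (x : DSum k L) (h0 : p 0)
    (hof : ∀ n x, p (DSum.of k L n x)) (hadd : ∀ x y, p x → p y → p (x + y)) : p x :=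
  DirectSum.induction_on (β := L) x h0 hof hadd

theorem DSum.comp_of_same (n : ℕ) (x : L n) : DSum.comp k L n (DSum.of k L n x) = x :=
  DirectSum.component.lof_self k (M := L) n x

theorem DSum.comp_of_ne {m n : ℕ} (h : m ≠ n) (x : L m) :
    DSum.comp k L n (DSum.of k L m x) = 0 :=
  (DirectSum.component.of k (M := L) n m x).trans (dif_neg h)

theorem DSum.eq_sum (x : DSum k L) :
    ∃ s : Finset ℕ, x = ∑ i ∈ s, DSum.of k L i (DSum.comp k L i x) := by
  classical
  exact ⟨_, (DirectSum.sum_support_of (β := L) x).symm⟩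

theorem Completion.ext {x y : Completion k L}
    (h : ∀ n, Completion.comp k L n x = Completion.comp k L n y) : x = y := funext h

theorem Completion.comp_trunc {m n : ℕ} (h : m ≤ n) (x : Completion k L) :
    DSum.comp k L m (Completion.trunc k L n x) = Completion.comp k L m x := by
  rw [trunc, LinearMap.sum_apply, map_sum, Finset.sum_eq_single m]
  · exact DSum.comp_of_same m _
  · intro i _ hi
    exact DSum.comp_of_ne hi _
  · intro h'
    exact absurd (Finset.mem_range.2 (by omega)) h'

end Modules

variable (k : Type*) [CommRing k] (L : ℕ → Type*)
    [∀ n, AddCommGroup (L n)] [∀ n, Module k (L n)] [GradedLie k L]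

/-- The bracket of `⨁ₙ Lₙ`: the bilinear extension of the brackets of homogeneous elements. -/
def DSum.brHom : DSum k L →ₗ[k] DSum k L →ₗ[k] DSum k L :=
  DirectSum.toModule k ℕ (DSum k L →ₗ[k] DSum k L) fun i =>
    LinearMap.flip (DirectSum.toModule k ℕ (L i →ₗ[k] DSum k L) fun j =>
      LinearMap.flip ((br (k := k) (L := L) i j).compr₂ (DSum.of k L (i + j))))

theorem DSum.brHom_of_of (i j : ℕ) (x : L i) (y : L j) :
    DSum.brHom k L (DSum.of k L i x) (DSum.of k L j y) =
      DSum.of k L (i + j) (br (k := k) (L := L) i j x y) := by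
  have h1 := DirectSum.toModule_lof k (φ := fun i => LinearMap.flip
        (DirectSum.toModule k ℕ (L i →ₗ[k] DSum k L) fun j =>
        LinearMap.flip ((br (k := k) (L := L) i j).compr₂ (DSum.of k L (i + j))))) i x
  have h2 := DirectSum.toModule_lof k (φ := fun j =>
        LinearMap.flip ((br (k := k) (L := L) i j).compr₂ (DSum.of k L (i + j)))) j y
  exact (congrArg (fun f => f (DSum.of k L j y)) h1).trans (congrArg (fun f => f x) h2)

variable {k L}

theorem DSum.brHom_skew (x y : DSum k L) : DSum.brHom k L x y + DSum.brHom k L y x = 0 := by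
  induction x using DSum.induction with
  | h0 => simp
  | hadd x x' hx hx' =>
    simp only [map_add, LinearMap.add_apply]
    rw [add_add_add_comm, hx, hx', add_zero]
  | hof i x =>
    induction y using DSum.induction with
    | h0 => simp
    | hadd y y' hy hy' =>
      simp only [map_add, LinearMap.add_apply]
      rw [add_add_add_comm, hy, hy', add_zero]
    | hof j y =>
      rw [DSum.brHom_of_of, DSum.brHom_of_of]
      exact br_skew i j x y

theorem DSum.brHom_self (x : DSum k L) : DSum.brHom k L x x = 0 := by
  induction x using DSum.induction with
  | h0 => simp
  | hadd x x' hx hx' =>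
    simp only [map_add, LinearMap.add_apply]
    rw [hx, hx', zero_add, add_zero, add_comm, DSum.brHom_skew]
  | hof i x => rw [DSum.brHom_of_of, br_self, map_zero]

theorem DSum.brHom_leibniz (x y z : DSum k L) :
    DSum.brHom k L x (DSum.brHom k L y z) =
      DSum.brHom k L (DSum.brHom k L x y) z + DSum.brHom k L y (DSum.brHom k L x z) := by
  induction x using DSum.induction with
  | h0 => simp
  | hadd x x' hx hx' =>
    simp only [map_add, LinearMap.add_apply, hx, hx']
    abel
  | hof i x =>
    induction y using DSum.induction with
    | h0 => simp
    | hadd y y' hy hy' =>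
      simp only [map_add, LinearMap.add_apply, hy, hy']
      abel
    | hof j y =>
      induction z using DSum.induction with
      | h0 => simp
      | hadd z z' hz hz' =>
        simp only [map_add, hz, hz']
        abel
      | hof l z =>
        simp only [DSum.brHom_of_of]
        exact br_leibniz i j l x y z

instance : LieRing (DSum k L) where
  bracket x y := DSum.brHom k L x y
  add_lie x y z := by simp
  lie_add x y z := by simp
  lie_self := DSum.brHom_self
  leibniz_lie := DSum.brHom_leibniz

instance : LieAlgebra k (DSum k L) where
  lie_smul t x y := (DSum.brHom k L x).map_smul t y

theorem DSum.lie_of_of (i j : ℕ) (x : L i) (y : L j) :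
    ⁅DSum.of k L i x, DSum.of k L j y⁆ = DSum.of k L (i + j) (br (k := k) (L := L) i j x y) :=
  DSum.brHom_of_of k L i j x y


/-- Components of degree at most `n` of a bracket depend only on those of its arguments. -/
theorem DSum.comp_lie_eq_zero {n : ℕ} {u : DSum k L} (v : DSum k L)
    (hu : ∀ i ≤ n, DSum.comp k L i u = 0) : DSum.comp k L n ⁅u, v⁆ = 0 := by
  obtain ⟨s, hs⟩ := DSum.eq_sum u
  obtain ⟨t, ht⟩ := DSum.eq_sum v
  rw [hs, ht]
  change DSum.comp k L n (DSum.brHom k L _ _) = 0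
  rw [map_sum, map_sum]
  refine Finset.sum_eq_zero fun j _ => ?_
  rw [map_sum, LinearMap.sum_apply, map_sum]
  refine Finset.sum_eq_zero fun i _ => ?_
  rw [DSum.brHom_of_of]
  by_cases h : i ≤ n
  · rw [hu i h, map_zero, LinearMap.zero_apply, map_zero, map_zero]
  · exact DSum.comp_of_ne (by omega) _

theorem DSum.comp_lie_congr {n : ℕ} {u u' v v' : DSum k L}
    (hu : ∀ i ≤ n, DSum.comp k L i u = DSum.comp k L i u')
    (hv : ∀ i ≤ n, DSum.comp k L i v = DSum.comp k L i v') :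
    DSum.comp k L n ⁅u, v⁆ = DSum.comp k L n ⁅u', v'⁆ := by
  have h1 : DSum.comp k L n ⁅u - u', v⁆ = 0 :=
    DSum.comp_lie_eq_zero v fun i hi => by rw [map_sub, hu i hi, sub_self]
  have h2 : DSum.comp k L n ⁅v - v', u'⁆ = 0 :=
    DSum.comp_lie_eq_zero u' fun i hi => by rw [map_sub, hv i hi, sub_self]
  rw [sub_lie, map_sub, sub_eq_zero] at h1 h2
  rw [h1, ← lie_skew u' v, ← lie_skew u' v', map_neg, map_neg, h2]

namespace Completion

/-- The continuous extension of the bracket of `⨁ₙ Lₙ`. -/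
instance : Bracket (Completion k L) (Completion k L) :=
  ⟨fun x y n => DSum.comp k L n ⁅trunc k L n x, trunc k L n y⁆⟩

theorem comp_lie (n : ℕ) (x y : Completion k L) :
    comp k L n ⁅x, y⁆ = DSum.comp k L n ⁅trunc k L n x, trunc k L n y⁆ := rfl

theorem comp_lie_of_le {m n : ℕ} (h : m ≤ n) (x y : Completion k L) :
    comp k L m ⁅x, y⁆ = DSum.comp k L m ⁅trunc k L n x, trunc k L n y⁆ := by
  rw [comp_lie]
  refine DSum.comp_lie_congr (fun i hi => ?_) fun i hi => ?_ <;>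
    rw [comp_trunc hi, comp_trunc (hi.trans h)]

theorem comp_lie_lie (n : ℕ) (x y z : Completion k L) :
    comp k L n ⁅x, ⁅y, z⁆⁆ =
      DSum.comp k L n ⁅trunc k L n x, ⁅trunc k L n y, trunc k L n z⁆⁆ := by
  rw [comp_lie]
  refine DSum.comp_lie_congr (fun i hi => rfl) fun i hi => ?_
  rw [comp_trunc hi, comp_lie_of_le hi]

theorem comp_lie_lie' (n : ℕ) (x y z : Completion k L) :
    comp k L n ⁅⁅x, y⁆, z⁆ =
      DSum.comp k L n ⁅⁅trunc k L n x, trunc k L n y⁆, trunc k L n z⁆ := by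
  rw [comp_lie]
  refine DSum.comp_lie_congr (fun i hi => ?_) fun i hi => rfl
  rw [comp_trunc hi, comp_lie_of_le hi]

instance : LieRing (Completion k L) where
  add_lie x y z := Completion.ext fun n => by simp only [comp_lie, map_add, add_lie]
  lie_add x y z := Completion.ext fun n => by simp only [comp_lie, map_add, lie_add]
  lie_self x := Completion.ext fun n => by rw [comp_lie, lie_self, map_zero, map_zero]
  leibniz_lie x y z := Completion.ext fun n => by
    rw [map_add, comp_lie_lie, comp_lie_lie, comp_lie_lie', leibniz_lie, map_add]

instance : LieAlgebra k (Completion k L) where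
  lie_smul t x y := Completion.ext fun n => by simp only [comp_lie, map_smul, lie_smul]

end Completion

end GradedLie

section GradedLieMorphisms

variable (k : Type*) [CommRing k] (L L' : ℕ → Type*)
    [∀ n, AddCommGroup (L n)] [∀ n, Module k (L n)] [GradedLie k L]
    [∀ n, AddCommGroup (L' n)] [∀ n, Module k (L' n)] [GradedLie k L']

/-- Morphisms of graded Lie algebras: the degree-preserving morphisms of Lie algebras. -/
structure GradedLieHom extends GradedLie.DSum k L →ₗ⁅k⁆ GradedLie.DSum k L' where
  map_degree : ∀ (n : ℕ) (x : L n), ∃ y : L' n,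
    toLieHom (GradedLie.DSum.of k L n x) = GradedLie.DSum.of k L' n y

/-- Isomorphisms of graded Lie algebras: the degree-preserving isomorphisms of Lie algebras. -/
structure GradedLieEquiv extends GradedLie.DSum k L ≃ₗ⁅k⁆ GradedLie.DSum k L' where
  map_degree : ∀ (n : ℕ) (x : L n), ∃ y : L' n,
    toLieEquiv (GradedLie.DSum.of k L n x) = GradedLie.DSum.of k L' n y

variable {k L L'}

/-- The morphism of graded Lie algebras with prescribed homogeneous components. -/
def GradedLieHom.ofPieces (f : ∀ n, L n →ₗ[k] L' n)
    (hf : ∀ i j (x : L i) (y : L j), f (i + j) (GradedLie.br (k := k) (L := L) i j x y) =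
      GradedLie.br (k := k) (L := L') i j (f i x) (f j y)) : GradedLieHom k L L' :=
  let F : GradedLie.DSum k L →ₗ[k] GradedLie.DSum k L' :=
    DirectSum.toModule k ℕ (GradedLie.DSum k L') fun n => GradedLie.DSum.of k L' n ∘ₗ f n
  have hF : ∀ n x, F (GradedLie.DSum.of k L n x) = GradedLie.DSum.of k L' n (f n x) := fun n x =>
    DirectSum.toModule_lof k (φ := fun n => GradedLie.DSum.of k L' n ∘ₗ f n) n x
  { F with
    map_lie' := by
      intro x y
      change F (GradedLie.DSum.brHom k L x y) = GradedLie.DSum.brHom k L' (F x) (F y)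
      induction x using GradedLie.DSum.induction with
      | h0 => simp
      | hadd x x' hx hx' => simp only [map_add, LinearMap.add_apply, hx, hx']
      | hof i x =>
        induction y using GradedLie.DSum.induction with
        | h0 => simp
        | hadd y y' hy hy' => simp only [map_add, hy, hy']
        | hof j y => rw [GradedLie.DSum.brHom_of_of, hF, hF, hF, hf, GradedLie.DSum.brHom_of_of]
    map_degree := fun n x => ⟨f n x, hF n x⟩ }

end GradedLieMorphisms

section LowerCentralSeries

open scoped commutatorElement

variable (G : Type*) [Group G]

/-- The lower central series `Γₙ` of `G`, indexed so that `Γ₁ = G` and `Γₙ₊₁ = [Γₙ, G]` for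
`n ≥ 1`; for convenience also `Γ₀ = G`. -/
def lcsTerm (n : ℕ) : Subgroup G := (⊤ : Subgroup G).lowerCentralSeries (n - 1)

instance (n : ℕ) : (lcsTerm G n).Normal :=
  inferInstanceAs ((⊤ : Subgroup G).lowerCentralSeries (n - 1)).Normal

theorem lcsTerm_antitone : Antitone (lcsTerm G) := fun _ _ h =>
  (⊤ : Subgroup G).lowerCentralSeries_antitone (Nat.sub_le_sub_right h 1)

variable {G}

theorem commutator_commutator_le_of_rotate {H₁ H₂ H₃ N : Subgroup G} [N.Normal]
    (h1 : ⁅⁅H₂, H₃⁆, H₁⁆ ≤ N) (h2 : ⁅⁅H₃, H₁⁆, H₂⁆ ≤ N) : ⁅⁅H₁, H₂⁆, H₃⁆ ≤ N := by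
  have key : ∀ H : Subgroup G, H ≤ N ↔ H.map (QuotientGroup.mk' N) = ⊥ := fun H => by
    rw [Subgroup.map_eq_bot_iff, QuotientGroup.ker_mk']
  rw [key, Subgroup.map_commutator, Subgroup.map_commutator] at h1 h2 ⊢
  exact Subgroup.commutator_commutator_eq_bot_of_rotate h1 h2

theorem commutator_lowerCentralSeries_le (m n : ℕ) :
    ⁅(⊤ : Subgroup G).lowerCentralSeries m, (⊤ : Subgroup G).lowerCentralSeries n⁆ ≤
      (⊤ : Subgroup G).lowerCentralSeries (m + n + 1) := by
  induction n generalizing m with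
  | zero => exact le_rfl
  | succ n ih =>
    rw [Subgroup.commutator_comm, Subgroup.lowerCentralSeries_succ]
    refine commutator_commutator_le_of_rotate ?_ ?_
    · rw [Subgroup.commutator_comm ⊤]
      refine (ih (m + 1)).trans (le_of_eq ?_)
      congr 1
      omega
    · exact Subgroup.commutator_mono (ih m) le_rfl

theorem commutator_mem_lcsTerm {i j n : ℕ} (hn : n ≤ i + j) {a b : G} (ha : a ∈ lcsTerm G i)
    (hb : b ∈ lcsTerm G j) : ⁅a, b⁆ ∈ lcsTerm G n := by
  have h := commutator_lowerCentralSeries_le (i - 1) (j - 1)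
    (Subgroup.commutator_mem_commutator ha hb)
  exact (⊤ : Subgroup G).lowerCentralSeries_antitone (by omega) h

theorem conj_inv_mul_mem_lcsTerm {n : ℕ} {a : G} (g : G) (ha : a ∈ lcsTerm G n) :
    (g * a * g⁻¹)⁻¹ * a ∈ lcsTerm G (n + 1) := by
  have h : ⁅g, a⁻¹⁆ ∈ lcsTerm G (n + 1) :=
    commutator_mem_lcsTerm (i := 1) (by omega) (Subgroup.mem_top g) (inv_mem ha)
  simpa [commutatorElement_def, mul_assoc] using h

variable (G) in
/-- The successive quotient `Γₙ / Γₙ₊₁`. -/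
def LCSQuot (n : ℕ) : Type _ := lcsTerm G n ⧸ (lcsTerm G (n + 1)).subgroupOf (lcsTerm G n)

namespace LCSQuot

instance (n : ℕ) : Group (LCSQuot G n) :=
  inferInstanceAs (Group (lcsTerm G n ⧸ (lcsTerm G (n + 1)).subgroupOf (lcsTerm G n)))

variable (G) in
/-- The projection `Γₙ → Γₙ / Γₙ₊₁`. -/
def proj (n : ℕ) : lcsTerm G n →* LCSQuot G n := QuotientGroup.mk' _

theorem proj_surjective (n : ℕ) : Function.Surjective (proj G n) := QuotientGroup.mk'_surjective _

/-- The class in `Γₙ / Γₙ₊₁` of an element of `Γₙ`. -/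
def mk (n : ℕ) (g : G) (hg : g ∈ lcsTerm G n) : LCSQuot G n := proj G n ⟨g, hg⟩

theorem mk_eq_mk {n : ℕ} {g h : G} (hg : g ∈ lcsTerm G n) (hh : h ∈ lcsTerm G n) :
    mk n g hg = mk n h hh ↔ g⁻¹ * h ∈ lcsTerm G (n + 1) :=
  QuotientGroup.eq

theorem mk_mul {n : ℕ} {g h : G} (hg : g ∈ lcsTerm G n) (hh : h ∈ lcsTerm G n) :
    mk n (g * h) (mul_mem hg hh) = mk n g hg * mk n h hh := rfl

theorem mk_inv {n : ℕ} {g : G} (hg : g ∈ lcsTerm G n) :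
    mk n g⁻¹ (inv_mem hg) = (mk n g hg)⁻¹ := rfl

theorem mk_eq_one {n : ℕ} {g : G} (hg : g ∈ lcsTerm G n) :
    mk n g hg = 1 ↔ g ∈ lcsTerm G (n + 1) :=
  QuotientGroup.eq_one_iff _

theorem mk_conj {n : ℕ} {a : G} (g : G) (ha : a ∈ lcsTerm G n) :
    mk n (g * a * g⁻¹) (Subgroup.Normal.conj_mem inferInstance a ha g) = mk n a ha :=
  (mk_eq_mk _ _).2 (conj_inv_mul_mem_lcsTerm g ha)

instance (n : ℕ) : CommGroup (LCSQuot G n) where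
  mul_comm a b := by
    obtain ⟨⟨a, ha⟩, rfl⟩ := proj_surjective n a
    obtain ⟨⟨b, hb⟩, rfl⟩ := proj_surjective n b
    have h := mk_conj a hb
    have h' : mk n (a * b * a⁻¹) (Subgroup.Normal.conj_mem inferInstance b hb a) =
      mk n a ha * mk n b hb * (mk n a ha)⁻¹ := rfl
    rw [h', mul_inv_eq_iff_eq_mul] at h
    exact h

theorem mk_comm_mul_left {i j n : ℕ} (hn : i + j = n) {a a' b : G} (ha : a ∈ lcsTerm G i)
    (ha' : a' ∈ lcsTerm G i) (hb : b ∈ lcsTerm G j) :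
    mk n ⁅a * a', b⁆ (commutator_mem_lcsTerm hn.ge (mul_mem ha ha') hb) =
      mk n ⁅a, b⁆ (commutator_mem_lcsTerm hn.ge ha hb) *
        mk n ⁅a', b⁆ (commutator_mem_lcsTerm hn.ge ha' hb) := by
  have h := commutatorElement_mul_left_eq_conj_mul a a' b
  have hc := commutator_mem_lcsTerm hn.ge ha' hb
  rw [mul_comm, ← mk_conj a hc, ← mk_mul]
  congr 1

theorem mk_comm_mul_right {i j n : ℕ} (hn : i + j = n) {a b b' : G} (ha : a ∈ lcsTerm G i)
    (hb : b ∈ lcsTerm G j) (hb' : b' ∈ lcsTerm G j) :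
    mk n ⁅a, b * b'⁆ (commutator_mem_lcsTerm hn.ge ha (mul_mem hb hb')) =
      mk n ⁅a, b⁆ (commutator_mem_lcsTerm hn.ge ha hb) *
        mk n ⁅a, b'⁆ (commutator_mem_lcsTerm hn.ge ha hb') := by
  have h := commutatorElement_mul_right_eq_mul_conj a b b'
  have hc := commutator_mem_lcsTerm hn.ge ha hb'
  rw [← mk_conj b hc, ← mk_mul]
  congr 1
  rw [h]
  simp only [mul_assoc]

/-- The pairing `Γᵢ/Γᵢ₊₁ × Γⱼ/Γⱼ₊₁ → Γᵢ₊ⱼ/Γᵢ₊ⱼ₊₁` induced by the group commutator. -/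
def commHom (i j : ℕ) : LCSQuot G i →* LCSQuot G j →* LCSQuot G (i + j) :=
  QuotientGroup.lift _
    { toFun := fun a => QuotientGroup.lift _
        { toFun := fun b => mk (i + j) ⁅(a : G), (b : G)⁆ (commutator_mem_lcsTerm le_rfl a.2 b.2)
          map_one' := (mk_eq_one _).2 (by simp)
          map_mul' := fun b b' => mk_comm_mul_right rfl a.2 b.2 b'.2 }
        fun b hb => (mk_eq_one _).2
          (commutator_mem_lcsTerm (by omega) a.2 (Subgroup.mem_subgroupOf.1 hb))
      map_one' := by
        ext b
        obtain ⟨b, rfl⟩ := proj_surjective j b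
        exact (mk_eq_one _).2 (by simp)
      map_mul' := fun a a' => by
        ext b
        obtain ⟨b, rfl⟩ := proj_surjective j b
        exact mk_comm_mul_left rfl a.2 a'.2 b.2 }
    fun a ha => by
      ext b
      obtain ⟨b, rfl⟩ := proj_surjective j b
      exact (mk_eq_one _).2
        (commutator_mem_lcsTerm (by omega) (Subgroup.mem_subgroupOf.1 ha) b.2)

theorem commHom_mk {i j : ℕ} {a b : G} (ha : a ∈ lcsTerm G i) (hb : b ∈ lcsTerm G j) :
    commHom i j (mk i a ha) (mk j b hb) =
      mk (i + j) ⁅a, b⁆ (commutator_mem_lcsTerm le_rfl ha hb) := rfl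

theorem mk_comm_inv_right {i j n : ℕ} (hn : i + j = n) {a b : G} (ha : a ∈ lcsTerm G i)
    (hb : b ∈ lcsTerm G j) :
    mk n ⁅a, b⁻¹⁆ (commutator_mem_lcsTerm hn.ge ha (inv_mem hb)) =
      (mk n ⁅a, b⁆ (commutator_mem_lcsTerm hn.ge ha hb))⁻¹ := by
  subst hn
  rw [← commHom_mk ha (inv_mem hb), mk_inv hb, map_inv, commHom_mk]

theorem mk_comm_conj_right {i j n : ℕ} (hn : i + j = n) {a b : G} (g : G) (ha : a ∈ lcsTerm G i)
    (hb : b ∈ lcsTerm G j) :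
    mk n ⁅a, g * b * g⁻¹⁆ (commutator_mem_lcsTerm hn.ge ha
      (Subgroup.Normal.conj_mem inferInstance b hb g)) =
      mk n ⁅a, b⁆ (commutator_mem_lcsTerm hn.ge ha hb) := by
  subst hn
  rw [← commHom_mk ha (Subgroup.Normal.conj_mem inferInstance b hb g), mk_conj g hb, commHom_mk]

/-- The Jacobi identity, a consequence of the Hall-Witt identity. -/
theorem mk_leibniz {i j l n : ℕ} (hn : i + j + l = n) {x y z : G} (hx : x ∈ lcsTerm G i)
    (hy : y ∈ lcsTerm G j) (hz : z ∈ lcsTerm G l) :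
    mk n ⁅x, ⁅y, z⁆⁆ (commutator_mem_lcsTerm (by omega) hx (commutator_mem_lcsTerm le_rfl hy hz)) =
      mk n ⁅⁅x, y⁆, z⁆
        (commutator_mem_lcsTerm hn.ge (commutator_mem_lcsTerm le_rfl hx hy) hz) *
      mk n ⁅y, ⁅x, z⁆⁆
        (commutator_mem_lcsTerm (by omega) hy (commutator_mem_lcsTerm le_rfl hx hz)) := by
  have hxy := commutator_mem_lcsTerm le_rfl hx hy
  have hyz := commutator_mem_lcsTerm le_rfl hy hz
  have hzx := commutator_mem_lcsTerm le_rfl hz hx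
  have hxz := commutator_mem_lcsTerm le_rfl hx hz
  have e1 := mk_comm_conj_right hn y hxy hz
  have e2 := mk_comm_conj_right (n := n) (by omega) z hyz hx
  have e3 := mk_comm_conj_right (n := n) (by omega) x hzx hy
  have hw : mk n ⁅⁅x, y⁆, y * z * y⁻¹⁆ (commutator_mem_lcsTerm hn.ge hxy
        (Subgroup.Normal.conj_mem inferInstance z hz y)) *
      mk n ⁅⁅y, z⁆, z * x * z⁻¹⁆ (commutator_mem_lcsTerm (by omega) hyz
        (Subgroup.Normal.conj_mem inferInstance x hx z)) *
      mk n ⁅⁅z, x⁆, x * y * x⁻¹⁆ (commutator_mem_lcsTerm (by omega) hzx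
        (Subgroup.Normal.conj_mem inferInstance y hy x)) = 1 := by
    rw [← mk_mul, ← mk_mul, mk_eq_one, commutatorElement_commutatorElement_conj_mul]
    exact one_mem _
  rw [e1, e2, e3] at hw
  have f1 : mk n ⁅⁅y, z⁆, x⁆ (commutator_mem_lcsTerm (by omega) hyz hx) =
      (mk n ⁅x, ⁅y, z⁆⁆ (commutator_mem_lcsTerm (by omega) hx hyz))⁻¹ := by
    rw [← mk_inv]
    congr 1
    rw [commutatorElement_inv]
  have f2 : mk n ⁅⁅z, x⁆, y⁆ (commutator_mem_lcsTerm (by omega) hzx hy) =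
      mk n ⁅y, ⁅x, z⁆⁆ (commutator_mem_lcsTerm (by omega) hy hxz) := by
    rw [← inv_inj, ← mk_comm_inv_right (by omega) hy hxz, ← mk_inv]
    congr 1
    rw [commutatorElement_inv, commutatorElement_inv]
  rw [f1, f2, mul_right_comm, mul_inv_eq_one] at hw
  exact hw.symm

variable {H : Type*} [Group H]

theorem _root_.map_mem_lcsTerm (f : G →* H) {n : ℕ} {g : G} (hg : g ∈ lcsTerm G n) :
    f g ∈ lcsTerm H n := by
  have h : f g ∈ ((⊤ : Subgroup G).lowerCentralSeries (n - 1)).map f := ⟨g, hg, rfl⟩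
  rw [Subgroup.map_lowerCentralSeries] at h
  exact Subgroup.lowerCentralSeries_mono _ le_top h

/-- The map on the successive quotients induced by a group homomorphism. -/
def map (f : G →* H) (n : ℕ) : LCSQuot G n →* LCSQuot H n :=
  QuotientGroup.lift _
    { toFun := fun a => mk n (f a) (map_mem_lcsTerm f a.2)
      map_one' := (mk_eq_one _).2 (by simp)
      map_mul' := fun a b => by
        rw [← mk_mul]
        congr 1
        simp }
    fun a ha => (mk_eq_one _).2 (map_mem_lcsTerm f (Subgroup.mem_subgroupOf.1 ha))

theorem map_mk (f : G →* H) {n : ℕ} {g : G} (hg : g ∈ lcsTerm G n) :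
    map f n (mk n g hg) = mk n (f g) (map_mem_lcsTerm f hg) := rfl

end LCSQuot

end LowerCentralSeries

section AssociatedGraded

open scoped commutatorElement

variable (k : Type*) [CommRing k] (G : Type*) [Group G]

/-- The degree `n` piece `grₙ(G; k) = (Γₙ / Γₙ₊₁) ⊗ k` of the associated graded Lie algebra of `G`;
it is zero for `n = 0`. -/
abbrev GrPiece (n : ℕ) : Type _ := k ⊗[ℤ] Additive (LCSQuot G n)

variable {G}

/-- The element `[g] ⊗ 1` of `grₙ(G; k)` for `g ∈ Γₙ`. -/
def GrPiece.cls (n : ℕ) (g : G) (hg : g ∈ lcsTerm G n) : GrPiece k G n :=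
  1 ⊗ₜ[ℤ] Additive.ofMul (LCSQuot.mk n g hg)

variable (G)

/-- The commutator pairing as a biadditive map. -/
def LCSQuot.commLin (i j : ℕ) : Additive (LCSQuot G i) →ₗ[ℤ] Additive (LCSQuot G j) →ₗ[ℤ]
    Additive (LCSQuot G (i + j)) :=
  AddMonoidHom.toIntLinearMap
    { toFun := fun a => AddMonoidHom.toIntLinearMap
        (MonoidHom.toAdditive (LCSQuot.commHom i j a.toMul))
      map_zero' := by
        ext b
        simp
      map_add' := fun a a' => by
        ext b
        simp }

/-- The bracket of homogeneous elements,
`[s ⊗ x, t ⊗ y] = st ⊗ [x, y]`. -/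
def GrPiece.br (i j : ℕ) : GrPiece k G i →ₗ[k] GrPiece k G j →ₗ[k] GrPiece k G (i + j) :=
  TensorProduct.curry <|
    TensorProduct.AlgebraTensorModule.map (LinearMap.mul' k k)
        (TensorProduct.lift (LCSQuot.commLin G i j)) ∘ₗ
      (TensorProduct.AlgebraTensorModule.tensorTensorTensorComm ℤ ℤ k k k
        (Additive (LCSQuot G i)) k (Additive (LCSQuot G j))).toLinearMap

variable {k G}

theorem GrPiece.br_tmul {i j : ℕ} (s t : k) {a b : G} (ha : a ∈ lcsTerm G i)
    (hb : b ∈ lcsTerm G j) :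
    GrPiece.br k G i j (s ⊗ₜ Additive.ofMul (LCSQuot.mk i a ha))
      (t ⊗ₜ Additive.ofMul (LCSQuot.mk j b hb)) =
    (s * t) ⊗ₜ Additive.ofMul
      (LCSQuot.mk (i + j) ⁅a, b⁆ (commutator_mem_lcsTerm le_rfl ha hb)) := rfl

@[elab_as_elim]
theorem GrPiece.induction {n : ℕ} {p : GrPiece k G n → Prop} (x : GrPiece k G n) (h0 : p 0)
    (htmul : ∀ (s : k) (g : G) (hg : g ∈ lcsTerm G n),
      p (s ⊗ₜ Additive.ofMul (LCSQuot.mk n g hg)))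
    (hadd : ∀ x y, p x → p y → p (x + y)) : p x := by
  refine TensorProduct.induction_on x h0 (fun s y => ?_) hadd
  obtain ⟨⟨g, hg⟩, h⟩ := LCSQuot.proj_surjective n y.toMul
  have := htmul s g hg
  rwa [LCSQuot.mk, h] at this

theorem GrPiece.lof_congr {m n : ℕ} (h : m = n) (s : k) {g : G} (hg : g ∈ lcsTerm G m) :
    DirectSum.lof k ℕ (GrPiece k G) m (s ⊗ₜ Additive.ofMul (LCSQuot.mk m g hg)) =
      DirectSum.lof k ℕ (GrPiece k G) n (s ⊗ₜ Additive.ofMul (LCSQuot.mk n g (h ▸ hg))) := by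
  subst h
  rfl

theorem GrPiece.br_skew (i j : ℕ) (x : GrPiece k G i) (y : GrPiece k G j) :
    DirectSum.lof k ℕ (GrPiece k G) (i + j) (GrPiece.br k G i j x y) +
      DirectSum.lof k ℕ (GrPiece k G) (j + i) (GrPiece.br k G j i y x) = 0 := by
  induction x using GrPiece.induction with
  | h0 => simp
  | hadd x x' hx hx' =>
    simp only [map_add, LinearMap.add_apply]
    rw [add_add_add_comm, hx, hx', add_zero]
  | htmul s a ha =>
    induction y using GrPiece.induction with
    | h0 => simp
    | hadd y y' hy hy' =>
      simp only [map_add, LinearMap.add_apply]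
      rw [add_add_add_comm, hy, hy', add_zero]
    | htmul t b hb =>
      rw [GrPiece.br_tmul, GrPiece.br_tmul, GrPiece.lof_congr (add_comm j i), mul_comm t s,
        ← map_add, ← TensorProduct.tmul_add, ← ofMul_mul, ← LCSQuot.mk_mul,
        (LCSQuot.mk_eq_one _).2, ofMul_one, TensorProduct.tmul_zero, map_zero]
      rw [← commutatorElement_inv a b, mul_inv_cancel]
      exact one_mem _

theorem GrPiece.br_self (i : ℕ) (x : GrPiece k G i) : GrPiece.br k G i i x x = 0 := by
  induction x using GrPiece.induction with
  | h0 => simp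
  | hadd x x' hx hx' =>
    have h := GrPiece.br_skew i i x x'
    rw [← map_add] at h
    have h' := (DirectSum.of_injective (β := GrPiece k G) (i + i)) (h.trans (map_zero _).symm)
    simp only [map_add, LinearMap.add_apply]
    rw [hx, hx', zero_add, add_zero]
    exact (add_comm _ _).trans h'
  | htmul s a ha =>
    rw [GrPiece.br_tmul, (LCSQuot.mk_eq_one _).2, ofMul_one, TensorProduct.tmul_zero]
    rw [commutatorElement_self]
    exact one_mem _

theorem GrPiece.br_leibniz (i j l : ℕ) (x : GrPiece k G i) (y : GrPiece k G j)
    (z : GrPiece k G l) :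
    DirectSum.lof k ℕ (GrPiece k G) (i + (j + l))
        (GrPiece.br k G i (j + l) x (GrPiece.br k G j l y z)) =
      DirectSum.lof k ℕ (GrPiece k G) (i + j + l)
          (GrPiece.br k G (i + j) l (GrPiece.br k G i j x y) z) +
        DirectSum.lof k ℕ (GrPiece k G) (j + (i + l))
          (GrPiece.br k G j (i + l) y (GrPiece.br k G i l x z)) := by
  induction x using GrPiece.induction with
  | h0 => simp
  | hadd x x' hx hx' =>
    simp only [map_add, LinearMap.add_apply, hx, hx']
    abel
  | htmul r a ha =>
    induction y using GrPiece.induction with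
    | h0 => simp
    | hadd y y' hy hy' =>
      simp only [map_add, LinearMap.add_apply, hy, hy']
      abel
    | htmul s b hb =>
      induction z using GrPiece.induction with
      | h0 => simp
      | hadd z z' hz hz' =>
        simp only [map_add, hz, hz']
        abel
      | htmul t c hc =>
        rw [GrPiece.br_tmul s t hb hc, GrPiece.br_tmul r s ha hb, GrPiece.br_tmul r t ha hc,
          GrPiece.br_tmul, GrPiece.br_tmul, GrPiece.br_tmul,
          GrPiece.lof_congr (show i + (j + l) = i + j + l by omega),
          GrPiece.lof_congr (show j + (i + l) = i + j + l by omega),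
          LCSQuot.mk_leibniz rfl ha hb hc, ofMul_mul, TensorProduct.tmul_add, map_add,
          mul_assoc r s t, mul_left_comm s r t]

instance : GradedLie k (GrPiece k G) where
  br := GrPiece.br k G
  br_self := GrPiece.br_self
  br_skew := GrPiece.br_skew
  br_leibniz := GrPiece.br_leibniz

variable (k G) in
/-- The associated graded Lie algebra `gr(G; k) = ⨁ₙ (Γₙ / Γₙ₊₁) ⊗ k` of the group `G`. -/
abbrev Gr : Type _ := GradedLie.DSum k (GrPiece k G)

variable (k G) in
/-- The degree completion of `gr(G; k)`. -/
abbrev GrHat : Type _ := GradedLie.Completion k (GrPiece k G)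

variable {H : Type*} [Group H]

variable (k) in
/-- The map `grₙ(G; k) → grₙ(H; k)` induced by a group homomorphism. -/
def GrPiece.map (f : G →* H) (n : ℕ) : GrPiece k G n →ₗ[k] GrPiece k H n :=
  LinearMap.baseChange k (MonoidHom.toAdditive (LCSQuot.map f n)).toIntLinearMap

theorem GrPiece.map_tmul (f : G →* H) {n : ℕ} (s : k) {g : G} (hg : g ∈ lcsTerm G n) :
    GrPiece.map k f n (s ⊗ₜ Additive.ofMul (LCSQuot.mk n g hg)) =
      s ⊗ₜ Additive.ofMul (LCSQuot.mk n (f g) (map_mem_lcsTerm f hg)) := rfl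

variable (k) in
/-- The morphism of graded Lie algebras `gr(f) : gr(G; k) → gr(H; k)` induced by a group
homomorphism `f : G → H`. -/
def Gr.map (f : G →* H) : GradedLieHom k (GrPiece k G) (GrPiece k H) :=
  GradedLieHom.ofPieces (GrPiece.map k f) fun i j x y => by
    change GrPiece.map k f (i + j) (GrPiece.br k G i j x y) =
      GrPiece.br k H i j (GrPiece.map k f i x) (GrPiece.map k f j y)
    induction x using GrPiece.induction with
    | h0 => simp
    | hadd x x' hx hx' => simp only [map_add, LinearMap.add_apply, hx, hx']
    | htmul s a ha =>
      induction y using GrPiece.induction with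
      | h0 => simp
      | hadd y y' hy hy' => simp only [map_add, hy, hy']
      | htmul t b hb =>
        rw [GrPiece.br_tmul, GrPiece.map_tmul, GrPiece.map_tmul, GrPiece.map_tmul,
          GrPiece.br_tmul]
        congr 3
        exact map_commutatorElement f a b

end AssociatedGraded

section CompletedBialgebra

variable (k : Type*) [CommRing k] (A : Type*) [Ring A] [Bialgebra k A]

/-- The augmentation ideal `I = ker ε`. -/
def augIdeal : Ideal A := RingHom.ker (Bialgebra.counitAlgHom k A)

instance : (augIdeal k A).IsTwoSided := inferInstanceAs (RingHom.ker _).IsTwoSided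

/-- The quotient `A / Iⁿ`. -/
abbrev AugQuot (n : ℕ) : Type _ := A ⧸ augIdeal k A ^ n

/-- The projection `A / Iⁿ → A / Iᵐ` for `m ≤ n`. -/
def AugQuot.transition {m n : ℕ} (h : m ≤ n) : AugQuot k A n →ₐ[k] AugQuot k A m :=
  Ideal.Quotient.factorₐ k (Ideal.pow_le_pow_right h)

/-- The `I`-adic completion `lim A / Iⁿ`. -/
def augCompletion : Subalgebra k (∀ n, AugQuot k A n) where
  carrier := {x | ∀ m n (h : m ≤ n), AugQuot.transition k A h (x n) = x m}
  mul_mem' hx hy m n h := by rw [Pi.mul_apply, map_mul, hx, hy, Pi.mul_apply]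
  add_mem' hx hy m n h := by rw [Pi.add_apply, map_add, hx, hy, Pi.add_apply]
  algebraMap_mem' r m n h := AlgHom.commutes _ r

/-- The completed tensor product `lim (A / Iⁿ ⊗ A / Iⁿ)`. -/
def augCompletedTensor : Subalgebra k (∀ n, AugQuot k A n ⊗[k] AugQuot k A n) where
  carrier := {x | ∀ m n (h : m ≤ n), Algebra.TensorProduct.map (AugQuot.transition k A h)
    (AugQuot.transition k A h) (x n) = x m}
  mul_mem' hx hy m n h := by rw [Pi.mul_apply, map_mul, hx, hy, Pi.mul_apply]
  add_mem' hx hy m n h := by rw [Pi.add_apply, map_add, hx, hy, Pi.add_apply]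
  algebraMap_mem' r m n h := AlgHom.commutes _ r

/-- The composite `A → A ⊗ A → A / Iⁿ ⊗ A / Iⁿ` of the comultiplication and the projection. -/
def AugQuot.comulAux (n : ℕ) : A →ₐ[k] AugQuot k A n ⊗[k] AugQuot k A n :=
  (Algebra.TensorProduct.map (Ideal.Quotient.mkₐ k (augIdeal k A ^ n))
    (Ideal.Quotient.mkₐ k (augIdeal k A ^ n))).comp (Bialgebra.comulAlgHom k A)

/-- The span in `A / Iⁿ ⊗ A / Iⁿ` of the images of the `Iⁱ ⊗ Iʲ` with `i + j = m`. -/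
def AugQuot.tensorFiltration (n m : ℕ) : Submodule k (AugQuot k A n ⊗[k] AugQuot k A n) :=
  Submodule.span k {z | ∃ i j x y, i + j = m ∧ x ∈ augIdeal k A ^ i ∧ y ∈ augIdeal k A ^ j ∧
    z = Ideal.Quotient.mk (augIdeal k A ^ n) x ⊗ₜ[k] Ideal.Quotient.mk (augIdeal k A ^ n) y}

variable {k A} in
theorem AugQuot.tmul_mem_tensorFiltration {n m i j : ℕ} {x y : A} (h : i + j = m)
    (hx : x ∈ augIdeal k A ^ i) (hy : y ∈ augIdeal k A ^ j) :
    Ideal.Quotient.mk (augIdeal k A ^ n) x ⊗ₜ[k] Ideal.Quotient.mk (augIdeal k A ^ n) y ∈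
      AugQuot.tensorFiltration k A n m :=
  Submodule.subset_span ⟨i, j, x, y, h, hx, hy, rfl⟩

theorem AugQuot.tensorFiltration_mul (n p q : ℕ) :
    AugQuot.tensorFiltration k A n p * AugQuot.tensorFiltration k A n q ≤
      AugQuot.tensorFiltration k A n (p + q) := by
  rw [AugQuot.tensorFiltration, AugQuot.tensorFiltration, Submodule.span_mul_span,
    Submodule.span_le]
  rintro _ ⟨_, ⟨i, j, x, y, h, hx, hy, rfl⟩, _, ⟨i', j', x', y', h', hx', hy', rfl⟩, rfl⟩
  simp only [Algebra.TensorProduct.tmul_mul_tmul, ← map_mul]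
  refine AugQuot.tmul_mem_tensorFiltration (i := i + i') (j := j + j') (by omega) ?_ ?_
  · rw [Ideal.IsTwoSided.pow_add]
    exact Ideal.mul_mem_mul hx hx'
  · rw [Ideal.IsTwoSided.pow_add]
    exact Ideal.mul_mem_mul hy hy'

variable {k A} in
theorem AugQuot.mem_pow_zero (x : A) : x ∈ augIdeal k A ^ 0 := by
  rw [Submodule.pow_zero, Ideal.one_eq_top]
  exact Submodule.mem_top

theorem AugQuot.comulAux_mem_one (n : ℕ) (a : A) (ha : a ∈ augIdeal k A) :
    AugQuot.comulAux k A n a ∈ AugQuot.tensorFiltration k A n 1 := by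
  let r := Coalgebra.Repr.arbitrary k a
  let q := Ideal.Quotient.mkₐ k (augIdeal k A ^ n)
  have e : Coalgebra.comul (R := k) a = ∑ i ∈ r.index,
      (r.left i - algebraMap k A (Coalgebra.counit (R := k) (r.left i))) ⊗ₜ[k] r.right i +
        1 ⊗ₜ[k] a := by
    have h : (1 : A) ⊗ₜ[k] a = ∑ i ∈ r.index,
        1 ⊗ₜ[k] (Coalgebra.counit (R := k) (r.left i) • r.right i) := by
      rw [← TensorProduct.tmul_sum, Coalgebra.sum_counit_smul r]
    rw [h, ← Finset.sum_add_distrib]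
    refine r.eq.symm.trans ?_
    refine Finset.sum_congr rfl fun i _ => ?_
    rw [TensorProduct.sub_tmul, Algebra.algebraMap_eq_smul_one, TensorProduct.smul_tmul,
      sub_add_cancel]
  change Algebra.TensorProduct.map q q (Coalgebra.comul (R := k) a) ∈ _
  rw [e, map_add, map_sum]
  refine add_mem (sum_mem fun i _ => ?_) ?_
  · rw [Algebra.TensorProduct.map_tmul]
    refine AugQuot.tmul_mem_tensorFiltration (i := 1) (j := 0) rfl ?_ (mem_pow_zero _)
    rw [Submodule.pow_one]
    change Bialgebra.counitAlgHom k A _ = 0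
    rw [map_sub, AlgHom.commutes]
    exact sub_self _
  · rw [Algebra.TensorProduct.map_tmul]
    refine AugQuot.tmul_mem_tensorFiltration (i := 0) (j := 1) rfl (mem_pow_zero _) ?_
    rwa [Submodule.pow_one]

theorem AugQuot.comulAux_mem (n m : ℕ) (a : A) (ha : a ∈ augIdeal k A ^ m) :
    AugQuot.comulAux k A n a ∈ AugQuot.tensorFiltration k A n m := by
  induction m generalizing a with
  | zero =>
    let r := Coalgebra.Repr.arbitrary k a
    let q := Ideal.Quotient.mkₐ k (augIdeal k A ^ n)
    change Algebra.TensorProduct.map q q (Coalgebra.comul (R := k) a) ∈ _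
    rw [← r.eq, map_sum]
    exact sum_mem fun i _ =>
      AugQuot.tmul_mem_tensorFiltration (i := 0) (j := 0) rfl (mem_pow_zero _) (mem_pow_zero _)
  | succ m ih =>
    rw [Ideal.IsTwoSided.pow_succ, add_comm] at *
    induction ha using Submodule.mul_induction_on' with
    | mem_mul_mem x hx y hy =>
      rw [map_mul]
      exact AugQuot.tensorFiltration_mul k A n 1 m
        (Submodule.mul_mem_mul (AugQuot.comulAux_mem_one k A n x hx) (ih y hy))
    | add x _ y _ hx hy => rw [map_add]; exact add_mem hx hy

theorem AugQuot.comulAux_eq_zero (n : ℕ) (a : A) (ha : a ∈ augIdeal k A ^ (n + n)) :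
    AugQuot.comulAux k A n a = 0 := by
  have h : AugQuot.tensorFiltration k A n (n + n) ≤ ⊥ := by
    rw [AugQuot.tensorFiltration, Submodule.span_le]
    rintro _ ⟨i, j, x, y, hij, hx, hy, rfl⟩
    rcases le_total n i with hi | hi
    · rw [Ideal.Quotient.eq_zero_iff_mem.2 (Ideal.pow_le_pow_right hi hx),
        TensorProduct.zero_tmul]
      exact zero_mem _
    · rw [Ideal.Quotient.eq_zero_iff_mem.2
        (Ideal.pow_le_pow_right (show n ≤ j by omega) hy), TensorProduct.tmul_zero]
      exact zero_mem _
  exact (Submodule.mem_bot k).1 (h (AugQuot.comulAux_mem k A n _ a ha))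

/-- The map `A / I²ⁿ → A / Iⁿ ⊗ A / Iⁿ` induced by the comultiplication. -/
def AugQuot.comul (n : ℕ) : AugQuot k A (n + n) →ₐ[k] AugQuot k A n ⊗[k] AugQuot k A n :=
  Ideal.Quotient.liftₐ _ (AugQuot.comulAux k A n) (AugQuot.comulAux_eq_zero k A n)

theorem AugQuot.comul_transition {m n : ℕ} (h : m ≤ n) (x : AugQuot k A (n + n)) :
    Algebra.TensorProduct.map (AugQuot.transition k A h) (AugQuot.transition k A h)
      (AugQuot.comul k A n x) =
    AugQuot.comul k A m (AugQuot.transition k A (add_le_add h h) x) := by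
  obtain ⟨a, rfl⟩ := Ideal.Quotient.mk_surjective x
  change Algebra.TensorProduct.map (AugQuot.transition k A h) (AugQuot.transition k A h)
    (Algebra.TensorProduct.map (Ideal.Quotient.mkₐ k (augIdeal k A ^ n))
      (Ideal.Quotient.mkₐ k (augIdeal k A ^ n)) (Bialgebra.comulAlgHom k A a)) =
    Algebra.TensorProduct.map (Ideal.Quotient.mkₐ k (augIdeal k A ^ m))
      (Ideal.Quotient.mkₐ k (augIdeal k A ^ m)) (Bialgebra.comulAlgHom k A a)
  rw [← AlgHom.comp_apply, ← Algebra.TensorProduct.map_comp]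
  rfl

namespace augCompletion

/-- The projection of the completion to `A / Iⁿ`. -/
def eval (n : ℕ) : augCompletion k A →ₐ[k] AugQuot k A n :=
  (Pi.evalAlgHom k (AugQuot k A) n).comp (augCompletion k A).val

variable {k A} in
theorem transition_eval {m n : ℕ} (h : m ≤ n) (x : augCompletion k A) :
    AugQuot.transition k A h (eval k A n x) = eval k A m x := x.2 m n h

/-- The comultiplication `Δ̂` of the completion, with values in the completed tensor product. -/
def comul : augCompletion k A →ₐ[k] augCompletedTensor k A :=
  AlgHom.codRestrict (AlgHom.pi fun n => (AugQuot.comul k A n).comp (eval k A (n + n))) _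
    fun x _ _ h =>
      (AugQuot.comul_transition k A h _).trans
        (congrArg (AugQuot.comul k A _) (transition_eval (add_le_add h h) x))

/-- The map `x ↦ x ⊗̂ 1`. -/
def inl : augCompletion k A →ₐ[k] augCompletedTensor k A :=
  AlgHom.codRestrict (AlgHom.pi fun n => Algebra.TensorProduct.includeLeft.comp (eval k A n)) _
    fun x m n h => by
      change Algebra.TensorProduct.map _ _ (eval k A n x ⊗ₜ[k] 1) = eval k A m x ⊗ₜ[k] 1
      rw [Algebra.TensorProduct.map_tmul, map_one, transition_eval]

/-- The map `x ↦ 1 ⊗̂ x`. -/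
def inr : augCompletion k A →ₐ[k] augCompletedTensor k A :=
  AlgHom.codRestrict (AlgHom.pi fun n => Algebra.TensorProduct.includeRight.comp (eval k A n)) _
    fun x m n h => by
      change Algebra.TensorProduct.map _ _ (1 ⊗ₜ[k] eval k A n x) = 1 ⊗ₜ[k] eval k A m x
      rw [Algebra.TensorProduct.map_tmul, map_one, transition_eval]

theorem inl_mul_inr (x y : augCompletion k A) :
    inl k A x * inr k A y = inr k A y * inl k A x := by
  refine Subtype.ext (funext fun n => ?_)
  change (eval k A n x ⊗ₜ[k] 1) * (1 ⊗ₜ[k] eval k A n y) =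
    (1 ⊗ₜ[k] eval k A n y) * (eval k A n x ⊗ₜ[k] 1)
  simp only [Algebra.TensorProduct.tmul_mul_tmul, one_mul, mul_one]

/-- The commutator bracket `[x, y] = xy - yx`. -/
instance : LieRing (augCompletion k A) := LieRing.ofAssociativeRing

instance : LieAlgebra k (augCompletion k A) := LieAlgebra.ofAssociativeAlgebra

/-- The Lie algebra of primitive elements: those with `Δ̂ x = x ⊗̂ 1 + 1 ⊗̂ x`. -/
def primitives : LieSubalgebra k (augCompletion k A) where
  carrier := {x | comul k A x = inl k A x + inr k A x}
  add_mem' {x y} hx hy := by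
    rw [Set.mem_ofPred_eq] at hx hy ⊢
    rw [map_add, map_add, map_add, hx, hy, add_add_add_comm]
  zero_mem' := by
    rw [Set.mem_ofPred_eq, map_zero, map_zero, map_zero, add_zero]
  smul_mem' c x hx := by
    rw [Set.mem_ofPred_eq] at hx ⊢
    rw [map_smul, map_smul, map_smul, hx, smul_add]
  lie_mem' {x y} hx hy := by
    have hx : comul k A x = inl k A x + inr k A x := hx
    have hy : comul k A y = inl k A y + inr k A y := hy
    change comul k A (x * y - y * x) = inl k A (x * y - y * x) + inr k A (x * y - y * x)
    simp only [map_sub, map_mul, hx, hy, add_mul, mul_add, inl_mul_inr]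
    abel

/-- The inverse limit filtration: the `n`-th term is the kernel of the projection to `A / Iⁿ`. -/
def filtration (n : ℕ) : Submodule k (augCompletion k A) :=
  LinearMap.ker (eval k A n).toLinearMap

end augCompletion

end CompletedBialgebra

section FilteredFormality

variable (k : Type*) [CommRing k] (G : Type*) [Group G]

/-- The Malcev Lie algebra `𝔪(G; k)`: the primitive elements of the completed group algebra. -/
abbrev MalcevLie : Type _ := augCompletion.primitives k (MonoidAlgebra k G)

/-- The filtration of the Malcev Lie algebra induced from that of the completed group algebra. -/
def MalcevLie.filtration (n : ℕ) : Submodule k (MalcevLie k G) :=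
  (augCompletion.filtration k (MonoidAlgebra k G) n).comap
    (augCompletion.primitives k (MonoidAlgebra k G)).toSubmodule.subtype

variable {k G}

/-- `x ≡ g - 1` modulo the `n`-th term of the filtration of the completed group algebra. -/
def MalcevLie.CongrSubOne (n : ℕ) (x : MalcevLie k G) (g : G) : Prop :=
  augCompletion.eval k (MonoidAlgebra k G) n x =
    Ideal.Quotient.mk (augIdeal k (MonoidAlgebra k G) ^ n) (MonoidAlgebra.of k G g - 1)

variable (k G)

/-- `G` is filtered-formal over `k`: there is an isomorphism of filtered Lie algebras from the
Malcev Lie algebra to the degree completion of `gr(G; k)` which induces the identity on associated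
graded Lie algebras. Here `grₙ(G; k)` is identified with the `n`-th graded piece of `𝔪(G; k)` by
sending `[g] ⊗ 1`, for `g ∈ Γₙ`, to the class of the elements `x` of `𝔪(G; k)` with `x ≡ g - 1`
modulo the `(n + 1)`-st term of the filtration (for instance `x = log g`); these classes span the
`n`-th graded piece. -/
def IsFilteredFormal : Prop :=
  ∃ φ : MalcevLie k G ≃ₗ⁅k⁆ GrHat k G,
    (∀ (n : ℕ) (x : MalcevLie k G), x ∈ MalcevLie.filtration k G n ↔
      φ x ∈ GradedLie.Completion.filtration k (GrPiece k G) n) ∧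
    ∀ (n : ℕ) (g : G) (hg : g ∈ lcsTerm G n) (x : MalcevLie k G),
      MalcevLie.CongrSubOne (n + 1) x g →
        GradedLie.Completion.comp k (GrPiece k G) n (φ x) = GrPiece.cls k n g hg

/-- The homogeneous pieces of the `i`-th Chen Lie algebra `gr(G/G⁽ⁱ⁾; k)`, where `G⁽ⁱ⁾` is the
`i`-th term of the derived series with `G⁽⁰⁾ = G`. -/
abbrev ChenPiece (i n : ℕ) : Type _ := GrPiece k (G ⧸ derivedSeries G i) n

/-- The morphism `gr(pᵢ) : gr(G; k) → gr(G/G⁽ⁱ⁾; k)` induced by the projection. -/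
def chenProj (i : ℕ) : GradedLieHom k (GrPiece k G) (ChenPiece k G i) :=
  Gr.map k (QuotientGroup.mk' (derivedSeries G i))

/-- The Chen rank `θₙ(G) = dim grₙ(G/G''; k)`. -/
def chenRank (n : ℕ) : ℕ := Module.finrank k (ChenPiece k G 2 n)

end FilteredFormality

end

/-! Everything reduces to identifying one kernel. For a filtered-formal group `G`, the kernel of
`gr(G; k) → gr(G/G⁽ⁱ⁾; k)` is the `i`-th derived term of the Lie algebra `gr(G; k)` itself. That
term depends only on the graded Lie algebra and is preserved by every morphism, so `α` carries one
kernel into the other and descends along the projection. The descended map is unique because the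
projection is surjective. Uniqueness-style cancellation also makes the maps induced by an
isomorphism and its inverse mutually inverse, and the Chen ranks are the dimensions in the case `i =
2`.

One inclusion holds for every group: a bracket of classes of elements of `G⁽ʲ⁾` is the class of
their commutator, which lies in `G⁽ʲ⁺¹⁾` (`chenProj_eq_zero_of_mem_derivedTerm`). For the other, the
kernel in degree `n` is spanned by the classes of elements `g` of `Γₙ ∩ G⁽ⁱ⁾`
(`GrPiece.mem_span_of_map_mk'_eq_zero`), so it must be shown that such a class lies in the derived
term. This is `IsFilteredFormal.of_cls_mem_derivedTerm`, the only place where formality enters. By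
the Baker-Campbell-Hausdorff theorem, the logarithm of a product is a sum of logarithms up to
brackets, and the logarithm of a commutator is made of brackets alone. Hence, by induction on `i`,
`log g` modulo any power of the augmentation ideal comes from an element of the Malcev Lie algebra
whose image in the completion of `gr(G; k)` has all components in the `i`-th derived term
(`exists_mem_derivedImage_exp_eq`). Formality says that the degree `n` component of this image is
`[g] ⊗ 1`.

All analysis happens in the quotients `kG/Iⁿ`, where exponentials are finite sums. Logarithms, and
the differential equation behind Baker-Campbell-Hausdorff, are solved as fixed points of maps that
improve the filtration level by one, so no topology on the completion is needed. -/

noncomputable section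

/-! ### Exponential and logarithm in a nilpotently filtered ring. -/

section FilteredRing

variable {A : Type*} [Ring A] [Module ℚ A]

/-- A decreasing multiplicative filtration of a `ℚ`-algebra which vanishes from step `N` on. -/
structure IsNilpotentFiltration (F : ℕ → Submodule ℚ A) (N : ℕ) : Prop where
  antitone : Antitone F
  mul_mem : ∀ {p q : ℕ} {x y : A}, x ∈ F p → y ∈ F q → x * y ∈ F (p + q)
  eq_bot : F N = ⊥

namespace IsNilpotentFiltration

variable {F : ℕ → Submodule ℚ A} {N : ℕ} (hF : IsNilpotentFiltration F N)
include hF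

theorem eq_zero {n : ℕ} (hn : N ≤ n) {x : A} (hx : x ∈ F n) : x = 0 := by
  have := hF.antitone hn hx
  rwa [hF.eq_bot, Submodule.mem_bot] at this

theorem pow_succ_mem {x : A} (hx : x ∈ F 1) (m : ℕ) : x ^ (m + 1) ∈ F (m + 1) := by
  induction m with
  | zero => simpa using hx
  | succ m ih => rw [pow_succ]; exact hF.mul_mem ih hx

theorem pow_eq_zero {x : A} (hx : x ∈ F 1) : x ^ (N + 1) = 0 :=
  hF.eq_zero (Nat.le_succ N) (hF.pow_succ_mem hx N)

theorem isNilpotent {x : A} (hx : x ∈ F 1) : IsNilpotent x := ⟨_, hF.pow_eq_zero hx⟩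

/-- A contraction of an invariant subset has a fixed point. -/
theorem exists_fixedPoint {S : Set A} {T : A → A} {w₀ : A} (h₀ : w₀ ∈ S)
    (hS : ∀ w ∈ S, w ∈ F 1) (hT : ∀ w ∈ S, T w ∈ S)
    (h : ∀ r, 1 ≤ r → ∀ w ∈ S, ∀ w' ∈ S, w - w' ∈ F r → T w - T w' ∈ F (r + 1)) :
    ∃ w ∈ S, T w = w := by
  have hmem : ∀ r, T^[r] w₀ ∈ S := fun r => by
    induction r with
    | zero => exact h₀
    | succ r ih => rw [Function.iterate_succ_apply']; exact hT _ ih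
  -- Consecutive iterates agree to one more level at each step, so they coincide once the filtration
  -- has vanished.
  have hr : ∀ r, T^[r + 1] w₀ - T^[r] w₀ ∈ F (r + 1) := fun r => by
    induction r with
    | zero => exact sub_mem (hS _ (hmem 1)) (hS _ (hmem 0))
    | succ r ih =>
      rw [Function.iterate_succ_apply' T (r + 1), Function.iterate_succ_apply' T r]
      refine h _ (Nat.succ_pos r) _ (?_ : T (T^[r] w₀) ∈ S) _ (hmem r) ?_
      · exact hT _ (hmem r)
      · simpa only [Function.iterate_succ_apply'] using ih
  refine ⟨_, hmem N, ?_⟩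
  rw [← Function.iterate_succ_apply' T N]
  exact sub_eq_zero.1 (hF.eq_zero (Nat.le_succ N) (hr N))

theorem pow_sub_pow_mem {r : ℕ} {x y : A} (hx : x ∈ F 1) (hy : y ∈ F 1) (hxy : x - y ∈ F r)
    (m : ℕ) : x ^ (m + 1) - y ^ (m + 1) ∈ F (r + m) := by
  induction m with
  | zero => simpa using hxy
  | succ m ih =>
    have e : x ^ (m + 1 + 1) - y ^ (m + 1 + 1) =
        (x ^ (m + 1) - y ^ (m + 1)) * x + y ^ (m + 1) * (x - y) := by
      rw [pow_succ x (m + 1), pow_succ y (m + 1)]; noncomm_ring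
    rw [e]
    refine add_mem ?_ ?_
    · have := hF.mul_mem ih hx
      rwa [add_assoc] at this
    · have := hF.mul_mem (hF.pow_succ_mem hy m) hxy
      rwa [add_comm] at this

theorem exp_sub_one_sub_self {x : A} (hx : x ∈ F 1) : IsNilpotent.exp x - 1 - x =
    ∑ i ∈ Finset.range N, ((i + 1 + 1).factorial : ℚ)⁻¹ • x ^ (i + 1 + 1) := by
  have h : x ^ (N + 1 + 1) = 0 := by rw [pow_succ, hF.pow_eq_zero hx, zero_mul]
  rw [IsNilpotent.exp_eq_sum h, Finset.sum_range_succ', Finset.sum_range_succ']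
  simp

/-- The tail of the exponential begins with a quadratic term, and each extra factor from `F 1` gains
one level. The tail is therefore a contraction, which drives both the injectivity of `exp` and the
existence of logarithms. -/
theorem exp_tail_sub_mem {r : ℕ} {x y : A} (hx : x ∈ F 1) (hy : y ∈ F 1)
    (hxy : x - y ∈ F r) :
    (IsNilpotent.exp x - 1 - x) - (IsNilpotent.exp y - 1 - y) ∈ F (r + 1) := by
  rw [hF.exp_sub_one_sub_self hx, hF.exp_sub_one_sub_self hy, ← Finset.sum_sub_distrib]
  refine sum_mem fun i _ => ?_
  rw [← smul_sub]
  exact (F _).smul_mem _ (hF.antitone (by omega) (hF.pow_sub_pow_mem hx hy hxy (i + 1)))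

theorem exp_tail_mem {r : ℕ} (hr : 1 ≤ r) {x : A} (hx : x ∈ F r) :
    IsNilpotent.exp x - 1 - x ∈ F (r + 1) := by
  have := hF.exp_tail_sub_mem (r := r) (hF.antitone hr hx) (zero_mem _) (by simpa using hx)
  simpa using this

/-- If the exponentials agree, `x - y` is minus the difference of the tails, which lies one level
deeper than `x - y` is known to lie. Iterating pushes it to zero. -/
theorem exp_injOn {x y : A} (hx : x ∈ F 1) (hy : y ∈ F 1)
    (h : IsNilpotent.exp x = IsNilpotent.exp y) : x = y := by
  have key : ∀ r, x - y ∈ F (r + 1) := fun r => by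
    induction r with
    | zero => exact sub_mem hx hy
    | succ r ih =>
      have := hF.exp_tail_sub_mem hx hy ih
      rw [h] at this
      rw [← neg_mem_iff]
      convert this using 1
      abel
  exact sub_eq_zero.1 (hF.eq_zero (Nat.le_succ N) (key N))

/-- The logarithm is the fixed point of `x ↦ u - (exp x - 1 - x)`, so its power series is not
needed. -/
theorem exists_exp_eq {u : A} (hu : u ∈ F 1) : ∃ x ∈ F 1, IsNilpotent.exp x = 1 + u := by
  obtain ⟨x, hx, h⟩ := hF.exists_fixedPoint (S := F 1)
    (T := fun x => u - (IsNilpotent.exp x - 1 - x)) (zero_mem (F 1)) (fun _ h => h)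
    (fun w hw => sub_mem hu (hF.antitone (by omega) (hF.exp_tail_mem le_rfl hw)))
    (fun r hr w hw w' hw' hww => by
      have := hF.exp_tail_sub_mem hw' hw (r := r) (by rw [← neg_mem_iff]; simpa using hww)
      convert this using 1
      abel)
  refine ⟨x, hx, ?_⟩
  rw [sub_eq_iff_eq_add] at h
  rw [h]
  abel

/-- If `exp x - 1` lies in step `n` of the filtration, then it agrees with `x` up to step
`n + 1`. -/
theorem sub_mem_of_exp {n : ℕ} (hn : 1 ≤ n) {x : A} (hx : x ∈ F 1)
    (h : IsNilpotent.exp x - 1 ∈ F n) : x - (IsNilpotent.exp x - 1) ∈ F (n + 1) := by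
  -- Bootstrapping: `x` is `exp x - 1` minus the tail, and the tail is always one level deeper than
  -- `x`, so `x` climbs up to level `n`.
  have key : ∀ r, r + 1 ≤ n → x ∈ F (r + 1) := fun r => by
    induction r with
    | zero => exact fun _ => hx
    | succ r ih =>
      intro hr
      have h1 := hF.exp_tail_mem (by omega) (ih (by omega))
      have h2 := sub_mem (hF.antitone hr h) h1
      simpa using h2
  have h3 := key (n - 1) (by omega)
  rw [Nat.sub_add_cancel hn] at h3
  have := neg_mem (hF.exp_tail_mem hn h3)
  convert this using 1
  abel

end IsNilpotentFiltration

end FilteredRing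

/-! ### Polynomial paths in a filtered ring, with a central time variable. -/

section PolynomialCoefficients

open Polynomial

variable {A : Type*} [Ring A] [Module ℚ A]

/-- The polynomials with coefficients in a given submodule. -/
def polyCoeffsIn (M : Submodule ℚ A) : Submodule ℚ A[X] where
  carrier := {p | ∀ n, p.coeff n ∈ M}
  add_mem' hp hq n := by rw [coeff_add]; exact add_mem (hp n) (hq n)
  zero_mem' n := by rw [coeff_zero]; exact zero_mem M
  smul_mem' c p hp n := by rw [coeff_smul]; exact M.smul_mem c (hp n)

theorem C_mem_polyCoeffsIn {M : Submodule ℚ A} {a : A} (ha : a ∈ M) : C a ∈ polyCoeffsIn M :=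
  fun n => by
    rw [coeff_C]
    split_ifs
    exacts [ha, zero_mem M]

theorem polyCoeffsIn_mono {M M' : Submodule ℚ A} (h : M ≤ M') : polyCoeffsIn M ≤ polyCoeffsIn M' :=
  fun _ hp n => h (hp n)

theorem mul_mem_polyCoeffsIn {M M' M'' : Submodule ℚ A}
    (h : ∀ x ∈ M, ∀ y ∈ M', x * y ∈ M'') {p q : A[X]} (hp : p ∈ polyCoeffsIn M)
    (hq : q ∈ polyCoeffsIn M') : p * q ∈ polyCoeffsIn M'' := fun n => by
  rw [coeff_mul]
  exact sum_mem fun i _ => h _ (hp _) _ (hq _)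

/-- As the variable is central, swapping indices in one of the two products writes each coefficient
of the bracket as a sum of brackets of coefficients. -/
theorem lie_mem_polyCoeffsIn {M M' M'' : Submodule ℚ A}
    (h : ∀ x ∈ M, ∀ y ∈ M', ⁅x, y⁆ ∈ M'') {p q : A[X]} (hp : p ∈ polyCoeffsIn M)
    (hq : q ∈ polyCoeffsIn M') : ⁅p, q⁆ ∈ polyCoeffsIn M'' := fun n => by
  rw [Ring.lie_def, coeff_sub, coeff_mul, coeff_mul,
    ← Finset.Nat.sum_antidiagonal_swap (f := fun i => q.coeff i.1 * p.coeff i.2),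
    ← Finset.sum_sub_distrib]
  exact sum_mem fun i _ => h _ (hp _) _ (hq _)

/-- Filtering coefficientwise keeps the same length `N`, so the fixed point argument and the
exponential apply to polynomial paths as well. -/
theorem IsNilpotentFiltration.poly {F : ℕ → Submodule ℚ A} {N : ℕ}
    (hF : IsNilpotentFiltration F N) :
    IsNilpotentFiltration (fun n => polyCoeffsIn (F n)) N where
  antitone _ _ h := polyCoeffsIn_mono (hF.antitone h)
  mul_mem hx hy := mul_mem_polyCoeffsIn (fun _ hx _ hy => hF.mul_mem hx hy) hx hy
  eq_bot := by
    refine (Submodule.eq_bot_iff _).2 fun p hp => ?_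
    ext n
    simpa [hF.eq_bot] using hp n

/-- The antiderivative of a polynomial with vanishing constant term. -/
def polyIntegral (p : A[X]) : A[X] :=
  p.sum fun n a => monomial (n + 1) ((n + 1 : ℚ)⁻¹ • a)

theorem coeff_polyIntegral_succ (p : A[X]) (n : ℕ) :
    (polyIntegral p).coeff (n + 1) = (n + 1 : ℚ)⁻¹ • p.coeff n := by
  rw [polyIntegral, Polynomial.sum, finsetSum_coeff, Finset.sum_eq_single n]
  · rw [coeff_monomial, if_pos rfl]
  · intro m _ hm
    rw [coeff_monomial, if_neg (by omega)]
  · intro h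
    rw [notMem_support_iff.1 h, smul_zero, map_zero, coeff_zero]

theorem coeff_polyIntegral_zero (p : A[X]) : (polyIntegral p).coeff 0 = 0 := by
  rw [polyIntegral, Polynomial.sum, finsetSum_coeff]
  refine Finset.sum_eq_zero fun m _ => ?_
  rw [coeff_monomial, if_neg (by omega)]

theorem polyIntegral_sub (p q : A[X]) :
    polyIntegral (p - q) = polyIntegral p - polyIntegral q := by
  ext n
  cases n with
  | zero => simp [coeff_polyIntegral_zero]
  | succ n => simp [coeff_polyIntegral_succ, smul_sub]

theorem derivative_polyIntegral (p : A[X]) : derivative (polyIntegral p) = p := by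
  ext n
  rw [coeff_derivative, coeff_polyIntegral_succ, smul_mul_assoc,
    show (n + 1 : A) = ((n + 1 : ℕ) : A) by push_cast; rfl,
    (Nat.cast_commute (n + 1) (p.coeff n)).symm.eq, ← nsmul_eq_mul, ← Nat.cast_smul_eq_nsmul ℚ,
    smul_smul]
  push_cast
  rw [inv_mul_cancel₀ (by positivity), one_smul]

theorem polyIntegral_mem {M : Submodule ℚ A} {p : A[X]} (hp : p ∈ polyCoeffsIn M) :
    polyIntegral p ∈ polyCoeffsIn M := fun n => by
  cases n with
  | zero => rw [coeff_polyIntegral_zero]; exact zero_mem M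
  | succ n => rw [coeff_polyIntegral_succ]; exact M.smul_mem _ (hp n)

/-- Evaluation at `1`. -/
def evalOneHom (A : Type*) [Ring A] : A[X] →+* A :=
  eval₂RingHom' (RingHom.id A) 1 fun _ => Commute.one_right _

omit [Module ℚ A] in
theorem evalOneHom_apply (p : A[X]) : evalOneHom A p = ∑ i ∈ p.support, p.coeff i := by
  change eval₂ (RingHom.id A) 1 p = _
  simp [eval₂_eq_sum, Polynomial.sum]

omit [Module ℚ A] in
theorem evalOneHom_C (a : A) : evalOneHom A (C a) = a := by
  change eval₂ (RingHom.id A) 1 (C a) = _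
  simp

omit [Module ℚ A] in
theorem evalOneHom_X : evalOneHom A X = 1 := by
  change eval₂ (RingHom.id A) 1 X = _
  simp

theorem evalOneHom_mem {M : Submodule ℚ A} {p : A[X]} (hp : p ∈ polyCoeffsIn M) :
    evalOneHom A p ∈ M := by
  rw [evalOneHom_apply]
  exact sum_mem fun i _ => hp i

/-- Taking the constant term. -/
def evalZeroHom (A : Type*) [Ring A] : A[X] →+* A :=
  eval₂RingHom' (RingHom.id A) 0 fun _ => Commute.zero_right _

omit [Module ℚ A] in
theorem evalZeroHom_apply (p : A[X]) : evalZeroHom A p = p.coeff 0 := by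
  change eval₂ (RingHom.id A) 0 p = _
  simp [eval₂_at_zero]

theorem eq_C_of_derivative_eq_zero' {p : A[X]} (h : derivative p = 0) : p = C (p.coeff 0) := by
  have : IsAddTorsionFree A := IsAddTorsionFree.of_module_rat A
  exact eq_C_of_derivative_eq_zero h

end PolynomialCoefficients

/-! ### The derivative of the exponential of a noncommutative path. -/

section DerivativeExp

open Polynomial

variable {A : Type*} [Ring A] [Module ℚ A]

/-- Differentiating `z ^ (n + 1)` leaves factors `z` to the right of `z'`. Moving them to the left
costs a bracket each, and the coefficients follow Pascal's rule. -/
theorem derivative_pow_succ_eq_sum_iterate_lie (z : A[X]) (n : ℕ) :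
    derivative (z ^ (n + 1)) = ∑ ij ∈ Finset.HasAntidiagonal.antidiagonal n,
      ((-1) ^ ij.2 * ((n + 1).choose (ij.2 + 1)) : ℚ) •
        (z ^ ij.1 * (fun w => ⁅z, w⁆)^[ij.2] (derivative z)) := by
  induction n with
  | zero => simp
  | succ n ih =>
    set W : ℕ → A[X] := fun j => (fun w => ⁅z, w⁆)^[j] (derivative z) with hW
    -- `W j` is `(ad z)ʲ z'`; this is the rule for moving `z` to the left.
    have hWs : ∀ j, W j * z = z * W j - W (j + 1) := fun j => by
      have : W (j + 1) = ⁅z, W j⁆ := Function.iterate_succ_apply' _ _ _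
      rw [this, Ring.lie_def]
      abel
    have hsplit : ∀ ij : ℕ × ℕ, ((-1) ^ ij.2 * ((n + 1 + 1).choose (ij.2 + 1)) : ℚ) •
        (z ^ ij.1 * W ij.2) =
        ((-1) ^ ij.2 * ((n + 1).choose ij.2) : ℚ) • (z ^ ij.1 * W ij.2) +
        ((-1) ^ ij.2 * ((n + 1).choose (ij.2 + 1)) : ℚ) • (z ^ ij.1 * W ij.2) := fun ij => by
      rw [← add_smul, Nat.choose_succ_succ (n + 1)]
      congr 1
      push_cast
      ring
    have hW0 : W 0 = derivative z := rfl
    rw [pow_succ, derivative_mul, ih]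
    change (∑ ij ∈ Finset.HasAntidiagonal.antidiagonal n, _ • (z ^ ij.1 * W ij.2)) * z + _ =
      ∑ ij ∈ Finset.HasAntidiagonal.antidiagonal (n + 1), ((-1) ^ ij.2 * ((n + 1 + 1).choose (ij.2 + 1)) : ℚ) •
        (z ^ ij.1 * W ij.2)
    rw [Finset.sum_congr rfl fun ij _ => hsplit ij, Finset.sum_add_distrib,
      Finset.Nat.sum_antidiagonal_succ', Finset.Nat.sum_antidiagonal_succ, Finset.sum_mul]
    have e : ∀ ij : ℕ × ℕ, ((-1) ^ ij.2 * ((n + 1).choose (ij.2 + 1)) : ℚ) •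
        (z ^ ij.1 * W ij.2) * z =
        ((-1) ^ (ij.2 + 1) * ((n + 1).choose (ij.2 + 1)) : ℚ) • (z ^ ij.1 * W (ij.2 + 1)) +
        ((-1) ^ ij.2 * ((n + 1).choose (ij.2 + 1)) : ℚ) • (z ^ (ij.1 + 1) * W ij.2) :=
      fun ij => by
        rw [smul_mul_assoc, mul_assoc, hWs, mul_sub, ← mul_assoc, ← pow_succ, smul_sub,
          pow_succ (-1 : ℚ), mul_neg_one, neg_mul, neg_smul]
        abel
    rw [Finset.sum_congr rfl fun ij _ => e ij, Finset.sum_add_distrib]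
    simp only [hW0, Nat.choose_succ_self, pow_zero, Nat.choose_zero_right, Nat.cast_one, one_mul,
      Nat.cast_zero, mul_zero, zero_smul, zero_add, one_smul]
    abel

variable {F : ℕ → Submodule ℚ A} {N : ℕ}

/-- The operator `(1 - exp (-ad z)) / ad z`, truncated after order `N`. -/
def lieExpFactor (N : ℕ) (z w : A[X]) : A[X] :=
  ∑ j ∈ Finset.range (N + 1), ((-1) ^ j * ((j + 1).factorial : ℚ)⁻¹) • (fun w => ⁅z, w⁆)^[j] w

theorem iterate_lie_mem (hF : IsNilpotentFiltration F N) {z w : A[X]}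
    (hz : z ∈ polyCoeffsIn (F 1)) (hw : w ∈ polyCoeffsIn (F 1)) (j : ℕ) :
    (fun w => ⁅z, w⁆)^[j] w ∈ polyCoeffsIn (F (j + 1)) := by
  induction j with
  | zero => exact hw
  | succ j ih =>
    rw [Function.iterate_succ_apply', Ring.lie_def]
    refine sub_mem ?_ (hF.poly.mul_mem ih hz)
    have := hF.poly.mul_mem hz ih
    rwa [add_comm 1] at this

/-- Dividing the formula for powers by `(n + 1)!` turns the binomial coefficient into `1 / (i! (j +
1)!)` with `i + j = n`. The double sum then factors as the exponential series times the series of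
`(1 - exp (-ad z)) / ad z`, applied to `z'`. -/
theorem derivative_exp (hF : IsNilpotentFiltration F N) {z : A[X]}
    (hz : z ∈ polyCoeffsIn (F 1)) (hz' : derivative z ∈ polyCoeffsIn (F 1)) :
    derivative (IsNilpotent.exp z) = IsNilpotent.exp z * lieExpFactor N z (derivative z) := by
  set W : ℕ → A[X] := fun j => (fun w => ⁅z, w⁆)^[j] (derivative z) with hW
  have hfac : ∀ n i, i ≤ n → ((n + 1).factorial : ℚ)⁻¹ * ((-1) ^ (n - i) *
      ((n + 1).choose (n - i + 1) : ℚ)) =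
      (i.factorial : ℚ)⁻¹ * ((-1) ^ (n - i) * ((n - i + 1).factorial : ℚ)⁻¹) := fun n i hi => by
    have := Nat.choose_mul_factorial_mul_factorial (n := n + 1) (k := n - i + 1) (by omega)
    rw [show n + 1 - (n - i + 1) = i by omega] at this
    have h' : ((n + 1).choose (n - i + 1) : ℚ) * (n - i + 1).factorial * i.factorial =
      (n + 1).factorial := by exact_mod_cast this
    have h1 : ((n + 1).factorial : ℚ) ≠ 0 := by positivity
    have h2 : ((n - i + 1).factorial : ℚ) ≠ 0 := by positivity
    have h3 : (i.factorial : ℚ) ≠ 0 := by positivity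
    field_simp
    rw [← h']
    ring
  -- The derivative gives a sum over the triangle `i + j < N`, the product a sum over a square; the
  -- terms in between vanish. The case `i = 0` is separate because `F 0` need not contain `1`.
  have hzero : ∀ i j, N ≤ i + j → z ^ i * W j = 0 := fun i j hij => by
    have hj : W j ∈ polyCoeffsIn (F (j + 1)) := iterate_lie_mem hF hz hz' j
    rcases i with _ | i
    · rw [pow_zero, one_mul]
      exact hF.poly.eq_zero (by omega) hj
    · exact hF.poly.eq_zero (by omega) (hF.poly.mul_mem (hF.poly.pow_succ_mem hz i) hj)
  have h1 : derivative (IsNilpotent.exp z) = ∑ n ∈ Finset.range N, ∑ i ∈ Finset.range (n + 1),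
      ((i.factorial : ℚ)⁻¹ * ((-1) ^ (n - i) * ((n - i + 1).factorial : ℚ)⁻¹)) •
        (z ^ i * W (n - i)) := by
    rw [IsNilpotent.exp_eq_sum (hF.poly.pow_eq_zero hz), derivative_sum, Finset.sum_range_succ']
    simp only [derivative_smul, derivative_pow_succ_eq_sum_iterate_lie]
    rw [pow_zero, derivative_one, smul_zero, add_zero]
    refine Finset.sum_congr rfl fun n _ => ?_
    rw [Finset.Nat.sum_antidiagonal_eq_sum_range_succ (fun i j =>
      ((-1) ^ j * ((n + 1).choose (j + 1)) : ℚ) • (z ^ i * W j)), Finset.smul_sum]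
    refine Finset.sum_congr rfl fun i hi => ?_
    rw [smul_smul, hfac n i (Nat.lt_succ_iff.1 (Finset.mem_range.1 hi))]
  rw [h1, Finset.sum_range_diag_flip N (fun i j => ((i.factorial : ℚ)⁻¹ *
    ((-1) ^ j * ((j + 1).factorial : ℚ)⁻¹)) • (z ^ i * W j)),
    IsNilpotent.exp_eq_sum (hF.poly.pow_eq_zero hz), lieExpFactor, Finset.sum_mul_sum,
    Finset.sum_range_succ _ N]
  rw [Finset.sum_eq_zero (s := Finset.range (N + 1)), add_zero]
  · refine Finset.sum_congr rfl fun i _ => ?_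
    rw [← Finset.sum_subset (Finset.range_subset_range.2 ((Nat.sub_le N i).trans (Nat.le_succ N)))]
    · refine Finset.sum_congr rfl fun j _ => ?_
      rw [smul_mul_assoc, mul_smul_comm, smul_smul]
    · intro j _ hj
      rw [Finset.mem_range] at hj
      rw [smul_mul_assoc, mul_smul_comm, hzero i j (by omega), smul_zero, smul_zero]
  · intro j _
    rw [smul_mul_assoc, mul_smul_comm, hzero N j (by omega), smul_zero, smul_zero]

end DerivativeExp

/-! ### Baker-Campbell-Hausdorff to first order. -/

section BakerCampbellHausdorff

open Polynomial

variable {A : Type*} [Ring A] [Module ℚ A] {F : ℕ → Submodule ℚ A} {N : ℕ}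

theorem lieExpFactor_eq_add (N : ℕ) (z w : A[X]) :
    lieExpFactor N z w = w + ∑ j ∈ Finset.range N,
      ((-1) ^ (j + 1) * ((j + 1 + 1).factorial : ℚ)⁻¹) • ⁅z, (fun w => ⁅z, w⁆)^[j] w⁆ := by
  rw [lieExpFactor, Finset.sum_range_succ', add_comm]
  simp [Function.iterate_succ_apply' (fun w => ⁅z, w⁆)]

/-- Each bracket with an element of level one gains a level. For `j ≥ 1` this is the contraction
estimate for the differential equation below. -/
theorem iterate_lie_sub_mem (hF : IsNilpotentFiltration F N) {z w z' w' : A[X]} {r : ℕ}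
    (hz' : z' ∈ polyCoeffsIn (F 1)) (hz : z ∈ polyCoeffsIn (F 1)) (hw : w ∈ polyCoeffsIn (F 1))
    (hzz : z - z' ∈ polyCoeffsIn (F r)) (hww : w - w' ∈ polyCoeffsIn (F r)) (j : ℕ) :
    (fun w => ⁅z, w⁆)^[j] w - (fun w => ⁅z', w⁆)^[j] w' ∈ polyCoeffsIn (F (r + j)) := by
  induction j with
  | zero => exact hww
  | succ j ih =>
    have hj := iterate_lie_mem hF hz hw j
    rw [Function.iterate_succ_apply', Function.iterate_succ_apply']
    set u := (fun w => ⁅z, w⁆)^[j] w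
    set u' := (fun w => ⁅z', w⁆)^[j] w'
    have e : ⁅z, u⁆ - ⁅z', u'⁆ = ((z - z') * u - u * (z - z')) +
        (z' * (u - u') - (u - u') * z') := by
      rw [Ring.lie_def, Ring.lie_def]
      noncomm_ring
    change ⁅z, u⁆ - ⁅z', u'⁆ ∈ _
    rw [e]
    have h1 := hF.poly.mul_mem hzz hj
    have h2 := hF.poly.mul_mem hj hzz
    have h3 := hF.poly.mul_mem hz' ih
    have h4 := hF.poly.mul_mem ih hz'
    refine add_mem (sub_mem h1 ?_) (sub_mem ?_ h4)
    · convert h2 using 2; congr 1; omega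
    · convert h3 using 2; congr 1; omega

/-- The Baker-Campbell-Hausdorff theorem to first order: `log (exp x * exp y)` agrees with `x + y`
up to commutators of elements of a Lie subalgebra which contains `x` and `y`. -/
theorem exists_exp_eq_exp_mul_exp (hF : IsNilpotentFiltration F N) {D E : Submodule ℚ A}
    (hED : E ≤ D) (hDF : D ≤ F 1) (hlie : ∀ x ∈ D, ∀ y ∈ D, ⁅x, y⁆ ∈ E) {x y : A}
    (hx : x ∈ D) (hy : y ∈ D) :
    ∃ z ∈ D, z - (x + y) ∈ E ∧ IsNilpotent.exp z = IsNilpotent.exp x * IsNilpotent.exp y := by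
  have hDF' := polyCoeffsIn_mono hDF
  -- The path sought is `z(t) = log (exp x * exp (t y))`. The unknown is its derivative `w`, from
  -- which `z` is recovered by integrating from `z(0) = x`.
  let Z : A[X] → A[X] := fun w => C x + polyIntegral w
  have hZ : ∀ w ∈ polyCoeffsIn D, Z w ∈ polyCoeffsIn D := fun w hw =>
    add_mem (C_mem_polyCoeffsIn hx) (polyIntegral_mem hw)
  -- The second condition survives the iteration because every correction to `y` is a bracket of
  -- paths in `D`; it is what finally gives `z - (x + y) ∈ E`.
  let S : Set A[X] := {w | w ∈ polyCoeffsIn D ∧ w - C y ∈ polyCoeffsIn E}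
  have hiter : ∀ z ∈ polyCoeffsIn D, ∀ w ∈ polyCoeffsIn D, ∀ j,
      (fun w => ⁅z, w⁆)^[j] w ∈ polyCoeffsIn D := fun z hz w hw j => by
    induction j with
    | zero => exact hw
    | succ j ih =>
      rw [Function.iterate_succ_apply']
      exact polyCoeffsIn_mono hED (lie_mem_polyCoeffsIn hlie hz ih)
  -- A fixed point satisfies `lieExpFactor N z w = y`, which is the equation `(exp z)' = exp z * y`.
  obtain ⟨w, ⟨hwD, hwE⟩, hw⟩ := hF.poly.exists_fixedPoint (S := S)
    (T := fun w => C y - (lieExpFactor N (Z w) w - w)) (w₀ := C y)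
    ⟨C_mem_polyCoeffsIn hy, by rw [sub_self]; exact zero_mem _⟩
    (fun w hw => hDF' hw.1)
    (fun w hw => by
      have h : lieExpFactor N (Z w) w - w ∈ polyCoeffsIn E := by
        rw [lieExpFactor_eq_add, add_sub_cancel_left]
        exact sum_mem fun j _ => (polyCoeffsIn E).smul_mem _
          (lie_mem_polyCoeffsIn hlie (hZ w hw.1) (hiter _ (hZ w hw.1) w hw.1 j))
      refine ⟨sub_mem (C_mem_polyCoeffsIn hy) (polyCoeffsIn_mono hED h), ?_⟩
      rw [sub_sub_cancel_left]
      exact neg_mem h)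
    (fun r hr w hw w' hw' hww => by
      have hz := hDF' (hZ w hw.1)
      have hz' := hDF' (hZ w' hw'.1)
      have hzz : Z w - Z w' ∈ polyCoeffsIn (F r) := by
        change C x + polyIntegral w - (C x + polyIntegral w') ∈ _
        rw [add_sub_add_left_eq_sub, ← polyIntegral_sub]
        exact polyIntegral_mem hww
      have e : C y - (lieExpFactor N (Z w) w - w) - (C y - (lieExpFactor N (Z w') w' - w')) =
          -∑ j ∈ Finset.range N, ((-1) ^ (j + 1) * ((j + 1 + 1).factorial : ℚ)⁻¹) •
            ((fun v => ⁅Z w, v⁆)^[j + 1] w - (fun v => ⁅Z w', v⁆)^[j + 1] w') := by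
        simp only [lieExpFactor_eq_add, Function.iterate_succ_apply', smul_sub,
          Finset.sum_sub_distrib]
        abel
      rw [e]
      refine neg_mem (sum_mem fun j _ => Submodule.smul_mem _ _ ?_)
      exact hF.poly.antitone (by omega)
        (iterate_lie_sub_mem hF hz' hz (hDF' hw.1) hzz hww (j + 1)))
  set z := Z w with hz
  have hz' : derivative z = w := by
    rw [hz]
    change derivative (C x + polyIntegral w) = w
    rw [derivative_add, derivative_C, zero_add, derivative_polyIntegral]
  have hzD : z ∈ polyCoeffsIn D := hZ w hwD
  have hzn := hF.poly.isNilpotent (hDF' hzD)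
  have hyn := hF.isNilpotent (hDF hy)
  have hfac : lieExpFactor N z w = C y := by
    have hw' : C y - (lieExpFactor N z w - w) = w := hw
    rw [sub_eq_iff_eq_add, add_sub_cancel] at hw'
    exact hw'.symm
  have hd : derivative (IsNilpotent.exp z) = IsNilpotent.exp z * C y := by
    rw [derivative_exp hF (hDF' hzD) (by rw [hz']; exact hDF' hwD), hz', hfac]
  -- `exp v = exp (-t y)` is the integrating factor. Since it commutes with `y`, the product `exp z
  -- * exp v` has zero derivative; comparing its values at `t = 0` and `t = 1` gives the claim.
  set v : A[X] := -(C y * X) with hv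
  have hvF : v ∈ polyCoeffsIn (F 1) := neg_mem fun n => by
    rcases n with _ | n
    · simp
    · rw [coeff_mul_X]
      exact C_mem_polyCoeffsIn (hDF hy) n
  have hv' : derivative v = -C y := by rw [hv, derivative_neg, derivative_C_mul_X]
  have hcomm : Commute v (-C y) := by
    refine Commute.neg_left (Commute.neg_right ?_)
    exact (Commute.refl (C y)).mul_left (commute_X (C y))
  have hdv : derivative (IsNilpotent.exp v) = IsNilpotent.exp v * -C y := by
    have h0 : ⁅v, -C y⁆ = 0 := by rw [Ring.lie_def, hcomm.eq, sub_self]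
    have hj : ∀ j, ⁅v, (fun w => ⁅v, w⁆)^[j] (-C y)⁆ = 0 := fun j => by
      rw [← Function.iterate_succ_apply' (fun w => ⁅v, w⁆), Function.iterate_succ_apply]
      rw [h0]
      exact Function.iterate_fixed (by rw [Ring.lie_def, mul_zero, zero_mul, sub_zero]) j
    rw [derivative_exp hF hvF (by rw [hv']; exact neg_mem (C_mem_polyCoeffsIn (hDF hy))), hv',
      lieExpFactor_eq_add, Finset.sum_eq_zero fun j _ => by rw [hj, smul_zero], add_zero]
  have hcomm' : Commute (IsNilpotent.exp v) (C y) := by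
    have h1 : Commute v (C y) := by simpa using hcomm.neg_right
    rw [IsNilpotent.exp]
    exact Commute.sum_left _ _ _ fun i _ => (h1.pow_left i).smul_left _
  have hconst := eq_C_of_derivative_eq_zero' (p := IsNilpotent.exp z * IsNilpotent.exp v) (by
    rw [derivative_mul, hd, hdv, mul_neg, hcomm'.eq, mul_neg, mul_assoc, add_neg_cancel])
  have hvn := hF.poly.isNilpotent hvF
  rw [← evalZeroHom_apply, map_mul, IsNilpotent.map_exp hzn, IsNilpotent.map_exp hvn] at hconst
  have hz0 : evalZeroHom A z = x := by
    rw [evalZeroHom_apply, hz]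
    change (C x + polyIntegral w).coeff 0 = x
    rw [coeff_add, coeff_C_zero, coeff_polyIntegral_zero, add_zero]
  have hv0 : evalZeroHom A v = 0 := by
    rw [evalZeroHom_apply, hv, coeff_neg, coeff_mul_X_zero, neg_zero]
  rw [hz0, hv0, IsNilpotent.exp_zero, mul_one] at hconst
  have hone := congrArg (evalOneHom A) hconst
  rw [map_mul, IsNilpotent.map_exp hzn, IsNilpotent.map_exp hvn, evalOneHom_C] at hone
  have hv1 : evalOneHom A v = -y := by
    rw [hv, map_neg, map_mul, evalOneHom_C, evalOneHom_X, mul_one]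
  refine ⟨evalOneHom A z, evalOneHom_mem hzD, ?_, ?_⟩
  -- The error term is the integral of `w - y` over `[0, 1]`, whose coefficients lie in `E`.
  · have : evalOneHom A z - (x + y) = evalOneHom A (polyIntegral (w - C y)) := by
      have hC : polyIntegral (C y) = C y * X := by
        ext n
        rcases n with _ | n
        · simp [coeff_polyIntegral_zero]
        · rw [coeff_polyIntegral_succ, coeff_mul_X, coeff_C]
          split_ifs with h <;> simp [h]
      rw [polyIntegral_sub, hC, map_sub, map_mul, evalOneHom_C, evalOneHom_X, mul_one, hz]
      change evalOneHom A (C x + polyIntegral w) - _ = _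
      rw [map_add, evalOneHom_C]
      abel
    rw [this]
    exact evalOneHom_mem (polyIntegral_mem hwE)
  · rw [← hone, hv1, mul_assoc, IsNilpotent.exp_neg_mul_exp_self hyn, mul_one]

/-- The group commutator of two exponentials is the exponential of a sum of Lie brackets. -/
theorem exists_exp_mul_exp_mul_eq (hF : IsNilpotentFiltration F N) {D E : Submodule ℚ A}
    (hED : E ≤ D) (hDF : D ≤ F 1) (hlie : ∀ x ∈ D, ∀ y ∈ D, ⁅x, y⁆ ∈ E) {x y : A}
    (hx : x ∈ D) (hy : y ∈ D) :
    ∃ z ∈ E, IsNilpotent.exp z * (IsNilpotent.exp y * IsNilpotent.exp x) =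
      IsNilpotent.exp x * IsNilpotent.exp y := by
  -- With `u = log (exp x * exp y)` and `v = log (exp y * exp x)`, both are `x + y` modulo `E`.
  -- Hence `log (exp u * exp (-v))`, which is `u - v` modulo `E`, lies in `E`.
  obtain ⟨u, hu, hu', hue⟩ := exists_exp_eq_exp_mul_exp hF hED hDF hlie hx hy
  obtain ⟨v, hv, hv', hve⟩ := exists_exp_eq_exp_mul_exp hF hED hDF hlie hy hx
  obtain ⟨z, -, hz', hze⟩ := exists_exp_eq_exp_mul_exp hF hED hDF hlie hu (neg_mem hv)
  refine ⟨z, ?_, ?_⟩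
  · have := add_mem hz' (sub_mem hu' hv')
    convert this using 1
    abel
  · rw [← hve, ← hue, hze, mul_assoc, IsNilpotent.exp_neg_mul_exp_self (hF.isNilpotent (hDF hv)),
      mul_one]

end BakerCampbellHausdorff

/-! ### Logarithms of group-like elements are primitive. -/

section LogarithmOfGroupLike

variable (k : Type*) [Field k] [CharZero k] (A : Type*) [Ring A] [Bialgebra k A]

/-- The image in `A / Iⁿ` of the powers of the augmentation ideal. -/
def AugQuot.filtration (n r : ℕ) : Submodule k (AugQuot k A n) :=
  ((augIdeal k A ^ r).restrictScalars k).map (Ideal.Quotient.mkₐ k (augIdeal k A ^ n)).toLinearMap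

variable {k A}

omit [CharZero k] in
theorem AugQuot.mk_mem_filtration {n r : ℕ} {a : A} (ha : a ∈ augIdeal k A ^ r) :
    Ideal.Quotient.mk (augIdeal k A ^ n) a ∈ AugQuot.filtration k A n r := ⟨a, ha, rfl⟩

theorem AugQuot.isNilpotentFiltration (n : ℕ) [Module ℚ (AugQuot k A n)] :
    IsNilpotentFiltration (fun r => (AugQuot.filtration k A n r).restrictScalars ℚ) n where
  antitone r s h := by
    rintro _ ⟨a, ha, rfl⟩
    exact ⟨a, Ideal.pow_le_pow_right h ha, rfl⟩
  mul_mem := by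
    rintro p q _ _ ⟨a, ha, rfl⟩ ⟨b, hb, rfl⟩
    refine ⟨a * b, ?_, map_mul (Ideal.Quotient.mkₐ k (augIdeal k A ^ n)) a b⟩
    change a * b ∈ augIdeal k A ^ (p + q)
    rw [Ideal.IsTwoSided.pow_add]
    exact Ideal.mul_mem_mul ha hb
  eq_bot := by
    refine (Submodule.eq_bot_iff _).2 ?_
    rintro _ ⟨a, ha, rfl⟩
    exact Ideal.Quotient.eq_zero_iff_mem.2 ha

/-- The length doubles to `n + n`: if `i + j = 2n`, then one of the two exponents is at least `n`
and that tensor factor dies in `A / Iⁿ`. -/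
theorem AugQuot.tensorFiltration_isNilpotentFiltration (n : ℕ)
    [Module ℚ (AugQuot k A n ⊗[k] AugQuot k A n)] :
    IsNilpotentFiltration
      (fun r => (AugQuot.tensorFiltration k A n r).restrictScalars ℚ) (n + n) where
  antitone := by
    refine antitone_nat_of_succ_le fun r => ?_
    change AugQuot.tensorFiltration k A n (r + 1) ≤ AugQuot.tensorFiltration k A n r
    rw [AugQuot.tensorFiltration, Submodule.span_le]
    rintro _ ⟨i, j, x, y, hij, hx, hy, rfl⟩
    rcases i with _ | i
    · refine AugQuot.tmul_mem_tensorFiltration (i := 0) (j := r) (zero_add r) hx ?_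
      exact Ideal.pow_le_pow_right (by omega) hy
    · refine AugQuot.tmul_mem_tensorFiltration (i := i) (j := j) (by omega) ?_ hy
      exact Ideal.pow_le_pow_right (by omega) hx
  mul_mem hx hy := AugQuot.tensorFiltration_mul k A n _ _ (Submodule.mul_mem_mul hx hy)
  eq_bot := by
    change (AugQuot.tensorFiltration k A n (n + n)).restrictScalars ℚ = ⊥
    rw [Submodule.restrictScalars_eq_bot_iff, eq_bot_iff, AugQuot.tensorFiltration,
      Submodule.span_le]
    rintro _ ⟨i, j, x, y, hij, hx, hy, rfl⟩
    rcases le_total n i with hi | hi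
    · rw [Ideal.Quotient.eq_zero_iff_mem.2 (Ideal.pow_le_pow_right hi hx),
        TensorProduct.zero_tmul]
      exact zero_mem _
    · rw [Ideal.Quotient.eq_zero_iff_mem.2
        (Ideal.pow_le_pow_right (show n ≤ j by omega) hy), TensorProduct.tmul_zero]
      exact zero_mem _

omit [CharZero k] in
theorem IsGroupLikeElem.sub_one_mem_augIdeal {a : A} (ha : IsGroupLikeElem k a) :
    a - 1 ∈ augIdeal k A := by
  change Bialgebra.counitAlgHom k A (a - 1) = 0
  rw [map_sub, map_one, sub_eq_zero]
  exact ha.counit_eq_one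

/-- A group-like element is the exponential of a primitive element of the completion. -/
theorem IsGroupLikeElem.exists_primitive_exp_eq [∀ n, Module ℚ (AugQuot k A n)] {a : A}
    (ha : IsGroupLikeElem k a) :
    ∃ x : augCompletion.primitives k A, ∀ n,
      augCompletion.eval k A n x ∈ AugQuot.filtration k A n 1 ∧
      IsNilpotent.exp (augCompletion.eval k A n x) = Ideal.Quotient.mk (augIdeal k A ^ n) a := by
  have hex : ∀ n, ∃ x ∈ AugQuot.filtration k A n 1,
      IsNilpotent.exp x = Ideal.Quotient.mk (augIdeal k A ^ n) a := fun n => by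
    have ha' : a - 1 ∈ augIdeal k A ^ 1 := by
      rw [Submodule.pow_one]
      exact ha.sub_one_mem_augIdeal
    have hu : Ideal.Quotient.mk (augIdeal k A ^ n) (a - 1) ∈ AugQuot.filtration k A n 1 :=
      AugQuot.mk_mem_filtration ha'
    obtain ⟨x, hx, h⟩ := (AugQuot.isNilpotentFiltration (k := k) (A := A) n).exists_exp_eq hu
    refine ⟨x, hx, h.trans ?_⟩
    rw [map_sub, map_one, add_sub_cancel]
  choose x hx hexp using hex
  have hnil : ∀ n, IsNilpotent (x n) := fun n =>
    (AugQuot.isNilpotentFiltration (k := k) (A := A) n).isNilpotent (hx n)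
  -- The logarithms chosen at different levels form a point of the completion because `exp` is
  -- injective at level one.
  have hcompat : ∀ m n (h : m ≤ n), AugQuot.transition k A h (x n) = x m := fun m n h => by
    refine (AugQuot.isNilpotentFiltration (k := k) (A := A) m).exp_injOn ?_ (hx m) ?_
    · obtain ⟨b, hb, hb'⟩ := hx n
      rw [← hb']
      exact ⟨b, hb, rfl⟩
    · rw [← IsNilpotent.map_exp (hnil n), hexp, hexp]
      rfl
  refine ⟨⟨⟨x, hcompat⟩, ?_⟩, fun n => ⟨hx n, hexp n⟩⟩
  refine Subtype.ext (funext fun n => ?_)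
  change AugQuot.comul k A n (x (n + n)) = x n ⊗ₜ[k] 1 + 1 ⊗ₜ[k] x n
  let : Module ℚ (AugQuot k A n ⊗[k] AugQuot k A n) := Module.compHom _ (algebraMap ℚ k)
  have hT := AugQuot.tensorFiltration_isNilpotentFiltration (k := k) (A := A) n
  have hleft : x n ⊗ₜ[k] (1 : AugQuot k A n) ∈ AugQuot.tensorFiltration k A n 1 := by
    obtain ⟨b, hb, hb'⟩ := hx n
    rw [← hb']
    exact AugQuot.tmul_mem_tensorFiltration (i := 1) (j := 0) (y := 1) rfl hb
      (AugQuot.mem_pow_zero _)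
  have hright : (1 : AugQuot k A n) ⊗ₜ[k] x n ∈ AugQuot.tensorFiltration k A n 1 := by
    obtain ⟨b, hb, hb'⟩ := hx n
    rw [← hb']
    exact AugQuot.tmul_mem_tensorFiltration (i := 0) (j := 1) (x := 1) rfl
      (AugQuot.mem_pow_zero _) hb
  -- Primitivity also follows from injectivity of `exp`: both sides have exponential `a ⊗ a`, the
  -- left since `a` is group-like, the right since `x ⊗ 1` and `1 ⊗ x` commute.
  refine hT.exp_injOn ?_ (add_mem hleft hright) ?_
  · obtain ⟨b, hb, hb'⟩ := hx (n + n)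
    rw [← hb']
    refine AugQuot.comulAux_mem_one k A n b ?_
    rw [← Submodule.pow_one (augIdeal k A)]
    exact hb
  · have hcomm : Commute (x n ⊗ₜ[k] (1 : AugQuot k A n)) ((1 : AugQuot k A n) ⊗ₜ[k] x n) := by
      rw [commute_iff_eq]
      simp only [Algebra.TensorProduct.tmul_mul_tmul, one_mul, mul_one]
    rw [← IsNilpotent.map_exp (hnil _), hexp,
      IsNilpotent.exp_add_of_commute hcomm (hT.isNilpotent hleft) (hT.isNilpotent hright)]
    have e1 : IsNilpotent.exp (x n ⊗ₜ[k] (1 : AugQuot k A n)) =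
        Ideal.Quotient.mk (augIdeal k A ^ n) a ⊗ₜ[k] 1 := by
      rw [← hexp n]
      exact (IsNilpotent.map_exp (hnil n) (Algebra.TensorProduct.includeLeft :
        AugQuot k A n →ₐ[k] AugQuot k A n ⊗[k] AugQuot k A n)).symm
    have e2 : IsNilpotent.exp ((1 : AugQuot k A n) ⊗ₜ[k] x n) =
        1 ⊗ₜ[k] Ideal.Quotient.mk (augIdeal k A ^ n) a := by
      rw [← hexp n]
      exact (IsNilpotent.map_exp (hnil n) (Algebra.TensorProduct.includeRight :
        AugQuot k A n →ₐ[k] AugQuot k A n ⊗[k] AugQuot k A n)).symm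
    rw [e1, e2, Algebra.TensorProduct.tmul_mul_tmul, one_mul, mul_one]
    change Algebra.TensorProduct.map _ _ (Coalgebra.comul (R := k) a) = _
    rw [ha.comul_eq_tmul_self, Algebra.TensorProduct.map_tmul]
    rfl

end LogarithmOfGroupLike

/-! ### Lower central series and powers of the augmentation ideal. -/

section DimensionSubgroups

open scoped commutatorElement

variable (k : Type*) [Field k] (G : Type*) [Group G]

theorem of_sub_one_mem_augIdeal (g : G) :
    MonoidAlgebra.of k G g - 1 ∈ augIdeal k (MonoidAlgebra k G) :=
  (MonoidAlgebra.isGroupLikeElem_of (R := k) (A := k) g).sub_one_mem_augIdeal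

/-- The dimension subgroup `{g | g - 1 ∈ Iⁿ}`. -/
def dimensionSubgroup (n : ℕ) : Subgroup G where
  carrier := {g | MonoidAlgebra.of k G g - 1 ∈ augIdeal k (MonoidAlgebra k G) ^ n}
  one_mem' := by
    change MonoidAlgebra.of k G 1 - 1 ∈ augIdeal k (MonoidAlgebra k G) ^ n
    rw [map_one, sub_self]
    exact zero_mem _
  mul_mem' {a b} ha hb := by
    change MonoidAlgebra.of k G (a * b) - 1 ∈ augIdeal k (MonoidAlgebra k G) ^ n
    have e : MonoidAlgebra.of k G (a * b) - 1 = MonoidAlgebra.of k G a *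
        (MonoidAlgebra.of k G b - 1) + (MonoidAlgebra.of k G a - 1) := by
      rw [map_mul, mul_sub, mul_one, sub_add_sub_cancel]
    rw [e]
    exact add_mem (Ideal.mul_mem_left _ _ hb) ha
  inv_mem' {a} ha := by
    change MonoidAlgebra.of k G a⁻¹ - 1 ∈ augIdeal k (MonoidAlgebra k G) ^ n
    have e : MonoidAlgebra.of k G a⁻¹ - 1 =
        MonoidAlgebra.of k G a⁻¹ * -(MonoidAlgebra.of k G a - 1) := by
      rw [neg_sub, mul_sub, mul_one, ← map_mul, inv_mul_cancel, map_one]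
    rw [e]
    exact Ideal.mul_mem_left _ _ (neg_mem ha)

variable {k G} in
theorem commutator_mem_dimensionSubgroup {m n : ℕ} {a b : G} (ha : a ∈ dimensionSubgroup k G m)
    (hb : b ∈ dimensionSubgroup k G n) : ⁅a, b⁆ ∈ dimensionSubgroup k G (m + n) := by
  set f := MonoidAlgebra.of k G with hf
  have ha' : f a - 1 ∈ augIdeal k (MonoidAlgebra k G) ^ m := ha
  have hb' : f b - 1 ∈ augIdeal k (MonoidAlgebra k G) ^ n := hb
  change f ⁅a, b⁆ - 1 ∈ augIdeal k (MonoidAlgebra k G) ^ (m + n)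
  -- A group commutator minus one is a ring commutator times a unit, so the exponents of the ideal
  -- add.
  have e : f ⁅a, b⁆ - 1 = ((f a - 1) * (f b - 1) - (f b - 1) * (f a - 1)) * f (a⁻¹ * b⁻¹) := by
    have h1 : (f a - 1) * (f b - 1) - (f b - 1) * (f a - 1) = f (a * b) - f (b * a) := by
      rw [map_mul, map_mul]
      noncomm_ring
    rw [h1, sub_mul, ← map_mul, ← map_mul, commutatorElement_def, ← map_one f]
    congr 2
    · simp only [mul_assoc]
    · group
  rw [e]
  refine Ideal.mul_mem_right _ _ (sub_mem ?_ ?_)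
  · rw [Ideal.IsTwoSided.pow_add]
    exact Ideal.mul_mem_mul ha' hb'
  · rw [add_comm, Ideal.IsTwoSided.pow_add]
    exact Ideal.mul_mem_mul hb' ha'

/-- Only this elementary inclusion is needed, not a description of the dimension subgroups. The
shift arises because `lowerCentralSeries n` is `Γₙ₊₁`. -/
theorem lowerCentralSeries_le_dimensionSubgroup (n : ℕ) :
    (⊤ : Subgroup G).lowerCentralSeries n ≤ dimensionSubgroup k G (n + 1) := by
  have htop : ∀ g : G, g ∈ dimensionSubgroup k G 1 := fun g => by
    change MonoidAlgebra.of k G g - 1 ∈ augIdeal k (MonoidAlgebra k G) ^ 1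
    rw [Submodule.pow_one]
    exact of_sub_one_mem_augIdeal k G g
  induction n with
  | zero => exact fun g _ => htop g
  | succ n ih =>
    rw [Subgroup.lowerCentralSeries_succ, Subgroup.commutator_le]
    exact fun a ha b _ => commutator_mem_dimensionSubgroup (ih ha) (htop b)

variable {G} in
theorem of_sub_one_mem_pow {n : ℕ} (hn : 1 ≤ n) {g : G} (hg : g ∈ lcsTerm G n) :
    MonoidAlgebra.of k G g - 1 ∈ augIdeal k (MonoidAlgebra k G) ^ n := by
  have := lowerCentralSeries_le_dimensionSubgroup k G (n - 1) hg
  rwa [Nat.sub_add_cancel hn] at this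

end DimensionSubgroups

/-! ### Derived series of a graded Lie algebra and of its completion. -/

namespace GradedLie

variable {k : Type*} [CommRing k] {L : ℕ → Type*}
    [∀ n, AddCommGroup (L n)] [∀ n, Module k (L n)] [GradedLie k L]

variable (k L) in
/-- The derived series of a graded Lie algebra, spanned in each step by the brackets of
homogeneous elements of the previous step. -/
def derivedTerm : ℕ → Submodule k (DSum k L)
  | 0 => ⊤
  | j + 1 => Submodule.span k {z | ∃ a b, ∃ (x : L a) (y : L b),
      DSum.of k L a x ∈ derivedTerm j ∧ DSum.of k L b y ∈ derivedTerm j ∧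
      z = ⁅DSum.of k L a x, DSum.of k L b y⁆}

theorem lie_of_of_mem_derivedTerm {j a b : ℕ} {x : L a} {y : L b}
    (hx : DSum.of k L a x ∈ derivedTerm k L j) (hy : DSum.of k L b y ∈ derivedTerm k L j) :
    ⁅DSum.of k L a x, DSum.of k L b y⁆ ∈ derivedTerm k L (j + 1) :=
  Submodule.subset_span ⟨a, b, x, y, hx, hy, rfl⟩

theorem derivedTerm_succ_le (j : ℕ) : derivedTerm k L (j + 1) ≤ derivedTerm k L j := by
  induction j with
  | zero => exact le_top
  | succ j ih =>
    refine Submodule.span_mono ?_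
    rintro _ ⟨a, b, x, y, hx, hy, rfl⟩
    exact ⟨a, b, x, y, ih hx, ih hy, rfl⟩

/-- The derived terms are graded subspaces, being spanned by brackets of homogeneous elements. -/
theorem of_comp_mem_derivedTerm {j : ℕ} {x : DSum k L} (hx : x ∈ derivedTerm k L j) (n : ℕ) :
    DSum.of k L n (DSum.comp k L n x) ∈ derivedTerm k L j := by
  rcases j with _ | j
  · exact Submodule.mem_top
  · induction hx using Submodule.span_induction with
    | mem z hz =>
      obtain ⟨a, b, x, y, hx, hy, rfl⟩ := hz
      have h := lie_of_of_mem_derivedTerm hx hy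
      rw [DSum.lie_of_of] at h ⊢
      by_cases hn : a + b = n
      · subst hn
        rwa [DSum.comp_of_same]
      · rw [DSum.comp_of_ne hn, map_zero]
        exact zero_mem _
    | zero => rw [map_zero, map_zero]; exact zero_mem _
    | add x y _ _ hx hy => rw [map_add, map_add]; exact add_mem hx hy
    | smul c x _ hx => rw [map_smul, map_smul]; exact Submodule.smul_mem _ c hx

/-- Splitting into components shows that restricting the generators to homogeneous elements loses
nothing: this is the usual derived series. -/
theorem lie_mem_derivedTerm {j : ℕ} {x y : DSum k L} (hx : x ∈ derivedTerm k L j)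
    (hy : y ∈ derivedTerm k L j) : ⁅x, y⁆ ∈ derivedTerm k L (j + 1) := by
  obtain ⟨s, hs⟩ := DSum.eq_sum x
  obtain ⟨t, ht⟩ := DSum.eq_sum y
  rw [hs, ht]
  change DSum.brHom k L _ _ ∈ _
  rw [map_sum, map_sum]
  refine sum_mem fun i _ => ?_
  rw [LinearMap.sum_apply]
  exact sum_mem fun l _ =>
    lie_of_of_mem_derivedTerm (of_comp_mem_derivedTerm hx l) (of_comp_mem_derivedTerm hy i)

theorem map_mem_derivedTerm {L' : ℕ → Type*} [∀ n, AddCommGroup (L' n)] [∀ n, Module k (L' n)]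
    [GradedLie k L'] (f : DSum k L →ₗ⁅k⁆ DSum k L') {j : ℕ} {x : DSum k L}
    (hx : x ∈ derivedTerm k L j) : f x ∈ derivedTerm k L' j := by
  induction j generalizing x with
  | zero => exact Submodule.mem_top
  | succ j ih =>
    induction hx using Submodule.span_induction with
    | mem z hz =>
      obtain ⟨a, b, x, y, hx, hy, rfl⟩ := hz
      rw [LieHom.map_lie]
      exact lie_mem_derivedTerm (ih hx) (ih hy)
    | zero => rw [map_zero]; exact zero_mem _
    | add x y _ _ hx hy => rw [map_add]; exact add_mem hx hy
    | smul c x _ hx => rw [map_smul]; exact Submodule.smul_mem _ c hx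

variable (k L) in
/-- The elements of the degree completion with all components in the derived series. -/
def Completion.derivedTerm (j : ℕ) : Submodule k (Completion k L) where
  carrier := {x | ∀ n, DSum.of k L n (Completion.comp k L n x) ∈ GradedLie.derivedTerm k L j}
  add_mem' hx hy n := by rw [map_add, map_add]; exact add_mem (hx n) (hy n)
  zero_mem' n := by rw [map_zero, map_zero]; exact zero_mem _
  smul_mem' c x hx n := by rw [map_smul, map_smul]; exact Submodule.smul_mem _ c (hx n)

/-- Each component of a bracket involves only finite truncations, so the statement reduces to the
direct sum. It concerns the componentwise terms, which need not be the algebraic derived series of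
the completion. -/
theorem Completion.lie_mem_derivedTerm {j : ℕ} {x y : Completion k L}
    (hx : x ∈ Completion.derivedTerm k L j) (hy : y ∈ Completion.derivedTerm k L j) :
    ⁅x, y⁆ ∈ Completion.derivedTerm k L (j + 1) := fun n => by
  have htrunc : ∀ z ∈ Completion.derivedTerm k L j,
      Completion.trunc k L n z ∈ GradedLie.derivedTerm k L j := fun z hz => by
    rw [Completion.trunc, LinearMap.sum_apply]
    exact sum_mem fun i _ => hz i
  rw [Completion.comp_lie]
  exact of_comp_mem_derivedTerm (GradedLie.lie_mem_derivedTerm (htrunc x hx) (htrunc y hy)) n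

end GradedLie

/-! ### Logarithms of elements of the derived series of a group. -/

section DerivedSeriesOfGroup

variable {k : Type*} [Field k] {G : Type*} [Group G]

/-- By convention `Γ₀ = Γ₁`. Hence the first step of the degree filtration is the whole completion,
and so all of the Malcev Lie algebra has level one. -/
instance : Subsingleton (GrPiece k G 0) := by
  have h : ∀ x : GrPiece k G 0, x = 0 := fun x => by
    induction x using GrPiece.induction with
    | h0 => rfl
    | htmul s g hg =>
      rw [(LCSQuot.mk_eq_one hg).2 (Subgroup.mem_top g), ofMul_one, TensorProduct.tmul_zero]
    | hadd x y hx hy => rw [hx, hy, add_zero]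
  exact ⟨fun x y => (h x).trans (h y).symm⟩

/-- The image in `kG / Iⁿ` of the elements of the Malcev Lie algebra which correspond to the `j`-th
term of the derived series of the associated graded Lie algebra. -/
def MalcevLie.derivedImage (φ : MalcevLie k G ≃ₗ⁅k⁆ GrHat k G) (n j : ℕ) :
    Submodule k (AugQuot k (MonoidAlgebra k G) n) :=
  ((GradedLie.Completion.derivedTerm k (GrPiece k G) j).comap
    (φ : MalcevLie k G →ₗ⁅k⁆ GrHat k G).toLinearMap).map
    ((augCompletion.eval k (MonoidAlgebra k G) n).toLinearMap ∘ₗ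
      (augCompletion.primitives k (MonoidAlgebra k G)).toSubmodule.subtype)

theorem MalcevLie.mem_derivedImage {φ : MalcevLie k G ≃ₗ⁅k⁆ GrHat k G} {n j : ℕ}
    {z : AugQuot k (MonoidAlgebra k G) n} :
    z ∈ MalcevLie.derivedImage φ n j ↔ ∃ x : MalcevLie k G,
      φ x ∈ GradedLie.Completion.derivedTerm k (GrPiece k G) j ∧
      augCompletion.eval k (MonoidAlgebra k G) n x = z := Iff.rfl

theorem MalcevLie.derivedImage_succ_le (φ : MalcevLie k G ≃ₗ⁅k⁆ GrHat k G) (n j : ℕ) :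
    MalcevLie.derivedImage φ n (j + 1) ≤ MalcevLie.derivedImage φ n j := by
  rintro _ ⟨x, hx, rfl⟩
  exact ⟨x, fun m => GradedLie.derivedTerm_succ_le j (hx m), rfl⟩

theorem MalcevLie.lie_mem_derivedImage (φ : MalcevLie k G ≃ₗ⁅k⁆ GrHat k G) (n j : ℕ)
    {z w : AugQuot k (MonoidAlgebra k G) n} (hz : z ∈ MalcevLie.derivedImage φ n j)
    (hw : w ∈ MalcevLie.derivedImage φ n j) : ⁅z, w⁆ ∈ MalcevLie.derivedImage φ n (j + 1) := by
  obtain ⟨x, hx, rfl⟩ := MalcevLie.mem_derivedImage.1 hz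
  obtain ⟨y, hy, rfl⟩ := MalcevLie.mem_derivedImage.1 hw
  refine MalcevLie.mem_derivedImage.2 ⟨⁅x, y⁆, ?_, ?_⟩
  · rw [LieEquiv.map_lie]
    exact GradedLie.Completion.lie_mem_derivedTerm hx hy
  · change augCompletion.eval k (MonoidAlgebra k G) n
      ((x : augCompletion k (MonoidAlgebra k G)) * y - y * x) = _
    rw [map_sub, map_mul, map_mul, Ring.lie_def]

theorem MalcevLie.derivedImage_le_filtration {φ : MalcevLie k G ≃ₗ⁅k⁆ GrHat k G}
    (hφ : ∀ (n : ℕ) (x : MalcevLie k G), x ∈ MalcevLie.filtration k G n ↔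
      φ x ∈ GradedLie.Completion.filtration k (GrPiece k G) n) (n j : ℕ) :
    MalcevLie.derivedImage φ (n + 1) j ≤ AugQuot.filtration k (MonoidAlgebra k G) (n + 1) 1 := by
  intro z hz
  obtain ⟨x, -, rfl⟩ := MalcevLie.mem_derivedImage.1 hz
  have h1 : x ∈ MalcevLie.filtration k G 1 := (hφ 1 x).2 fun i hi => by
    obtain rfl : i = 0 := by omega
    exact Subsingleton.elim (α := GrPiece k G 0) _ _
  have h2 : augCompletion.eval k (MonoidAlgebra k G) 1 x = 0 := h1
  obtain ⟨a, ha⟩ := Ideal.Quotient.mk_surjective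
    (augCompletion.eval k (MonoidAlgebra k G) (n + 1) x)
  rw [← augCompletion.transition_eval (show 1 ≤ n + 1 by omega), ← ha] at h2
  rw [← ha]
  exact AugQuot.mk_mem_filtration (Ideal.Quotient.eq_zero_iff_mem.1 h2)

variable [CharZero k]

/-- Induction on `j`. At the start every `g` has a primitive logarithm and there is no condition on
it. At each step, Baker-Campbell-Hausdorff shows that the elements with a logarithm in the next
derived image form a subgroup, and that this subgroup contains the generating commutators. -/
theorem exists_mem_derivedImage_exp_eq {φ : MalcevLie k G ≃ₗ⁅k⁆ GrHat k G}
    (hφ : ∀ (n : ℕ) (x : MalcevLie k G), x ∈ MalcevLie.filtration k G n ↔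
      φ x ∈ GradedLie.Completion.filtration k (GrPiece k G) n)
    [∀ n, Module ℚ (AugQuot k (MonoidAlgebra k G) n)] (n j : ℕ) {g : G}
    (hg : g ∈ derivedSeries G j) :
    ∃ z ∈ MalcevLie.derivedImage φ (n + 1) j, IsNilpotent.exp z =
      Ideal.Quotient.mk (augIdeal k (MonoidAlgebra k G) ^ (n + 1)) (MonoidAlgebra.of k G g) := by
  let q : G →* AugQuot k (MonoidAlgebra k G) (n + 1) :=
    (Ideal.Quotient.mk (augIdeal k (MonoidAlgebra k G) ^ (n + 1)) : _ →* _).comp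
      (MonoidAlgebra.of k G)
  change ∃ z ∈ MalcevLie.derivedImage φ (n + 1) j, IsNilpotent.exp z = q g
  have hF := AugQuot.isNilpotentFiltration (k := k) (A := MonoidAlgebra k G) (n + 1)
  have hDF : ∀ j, (MalcevLie.derivedImage φ (n + 1) j).restrictScalars ℚ ≤
      (AugQuot.filtration k (MonoidAlgebra k G) (n + 1) 1).restrictScalars ℚ :=
    MalcevLie.derivedImage_le_filtration hφ n
  have hnil : ∀ j, ∀ z ∈ MalcevLie.derivedImage φ (n + 1) j, IsNilpotent z := fun j z hz =>
    hF.isNilpotent (hDF j hz)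
  have hED : ∀ j, (MalcevLie.derivedImage φ (n + 1) (j + 1)).restrictScalars ℚ ≤
      (MalcevLie.derivedImage φ (n + 1) j).restrictScalars ℚ :=
    MalcevLie.derivedImage_succ_le φ (n + 1)
  have hlie : ∀ j, ∀ z ∈ (MalcevLie.derivedImage φ (n + 1) j).restrictScalars ℚ,
      ∀ w ∈ (MalcevLie.derivedImage φ (n + 1) j).restrictScalars ℚ,
      ⁅z, w⁆ ∈ (MalcevLie.derivedImage φ (n + 1) (j + 1)).restrictScalars ℚ := fun j z hz w hw =>
    MalcevLie.lie_mem_derivedImage φ (n + 1) j hz hw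
  induction j generalizing g with
  | zero =>
    obtain ⟨x, hx⟩ :=
      (MonoidAlgebra.isGroupLikeElem_of (R := k) (A := k) g).exists_primitive_exp_eq
    exact ⟨_, MalcevLie.mem_derivedImage.2 ⟨x, fun m => Submodule.mem_top, rfl⟩, (hx (n + 1)).2⟩
  | succ j ih =>
    let H : Subgroup G :=
      { carrier := {g | ∃ z ∈ MalcevLie.derivedImage φ (n + 1) (j + 1), IsNilpotent.exp z = q g}
        one_mem' := ⟨0, zero_mem _, by rw [IsNilpotent.exp_zero, map_one]⟩
        mul_mem' := by
          rintro a b ⟨x, hx, hxa⟩ ⟨y, hy, hyb⟩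
          obtain ⟨z, hz, -, h⟩ := exists_exp_eq_exp_mul_exp hF (hED (j + 1))
            (hDF (j + 1)) (hlie (j + 1)) hx hy
          exact ⟨z, hz, by rw [h, hxa, hyb, map_mul]⟩
        inv_mem' := by
          rintro a ⟨x, hx, hxa⟩
          refine ⟨-x, neg_mem hx, ?_⟩
          have h1 := IsNilpotent.exp_neg_mul_exp_self (hnil _ x hx)
          have h2 : q a * q a⁻¹ = 1 := by rw [← map_mul, mul_inv_cancel, map_one]
          rw [hxa] at h1
          exact left_inv_eq_right_inv h1 h2 }
    have hle : derivedSeries G (j + 1) ≤ H := by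
      rw [derivedSeries_succ, Subgroup.commutator_le]
      intro a ha b hb
      obtain ⟨x, hx, hxa⟩ := ih ha
      obtain ⟨y, hy, hyb⟩ := ih hb
      -- For commutators the linear terms `x + y` cancel, which moves the logarithm from step `j` to
      -- step `j + 1`.
      obtain ⟨z, hz, h⟩ := exists_exp_mul_exp_mul_eq hF (hED j) (hDF j) (hlie j) hx hy
      refine ⟨z, hz, ?_⟩
      rw [hxa, hyb, ← map_mul, ← map_mul] at h
      have h2 : q (b * a) * q (b * a)⁻¹ = 1 := by rw [← map_mul, mul_inv_cancel, map_one]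
      have h3 := congrArg (· * q (b * a)⁻¹) h
      simp only [mul_assoc, h2, mul_one] at h3
      rw [h3, ← map_mul, commutatorElement_def, mul_inv_rev, mul_assoc (a * b)]
    exact hle hg

/-- For a filtered-formal group, the classes of elements of the derived series of the group lie in
the derived series of its associated graded Lie algebra. -/
theorem IsFilteredFormal.of_cls_mem_derivedTerm (hG : IsFilteredFormal k G) {n i : ℕ} {g : G}
    (hg : g ∈ lcsTerm G n) (hgi : g ∈ derivedSeries G i) :
    GradedLie.DSum.of k (GrPiece k G) n (GrPiece.cls k n g hg) ∈
      GradedLie.derivedTerm k (GrPiece k G) i := by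
  rcases n with _ | n
  · rw [Subsingleton.elim (GrPiece.cls k 0 g hg) 0, map_zero]
    exact zero_mem _
  obtain ⟨φ, hφ, hcls⟩ := hG
  let : ∀ m, Module ℚ (AugQuot k (MonoidAlgebra k G) m) := fun m =>
    Module.compHom _ (algebraMap ℚ k)
  -- The degree is now `n + 1`, and working modulo `Iⁿ⁺²` is just fine enough to see that component.
  obtain ⟨z, hz, hzg⟩ := exists_mem_derivedImage_exp_eq hφ (n + 1) i hgi
  have hzF := MalcevLie.derivedImage_le_filtration hφ (n + 1) i hz
  have hF := AugQuot.isNilpotentFiltration (k := k) (A := MonoidAlgebra k G) (n + 1 + 1)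
  obtain ⟨x, hx, rfl⟩ := MalcevLie.mem_derivedImage.1 hz
  have hsub := of_sub_one_mem_pow k (show 1 ≤ n + 1 by omega) hg
  have hexp : IsNilpotent.exp (augCompletion.eval k (MonoidAlgebra k G) (n + 1 + 1) x) - 1 =
      Ideal.Quotient.mk (augIdeal k (MonoidAlgebra k G) ^ (n + 1 + 1))
        (MonoidAlgebra.of k G g - 1) := by rw [hzg, map_sub, map_one]
  -- Since `g - 1 ∈ Iⁿ⁺¹`, the logarithm and `g - 1` agree modulo `Iⁿ⁺²`. Formality then identifies
  -- the degree `n + 1` component of `φ x`, which lies in the derived term, with the class of `g`.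
  have hcongr : MalcevLie.CongrSubOne (n + 1 + 1) x g := by
    have hmem : IsNilpotent.exp (augCompletion.eval k (MonoidAlgebra k G) (n + 1 + 1) x) - 1 ∈
        AugQuot.filtration k (MonoidAlgebra k G) (n + 1 + 1) (n + 1) := by
      rw [hexp]
      exact AugQuot.mk_mem_filtration hsub
    have h := hF.eq_zero le_rfl (hF.sub_mem_of_exp (by omega) hzF hmem)
    rw [hexp] at h
    exact sub_eq_zero.1 h
  rw [← hcls (n + 1) g hg x hcongr]
  exact hx (n + 1)

end DerivedSeriesOfGroup

/-! ### Morphisms and isomorphisms of graded Lie algebras, and factorization. -/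

section GradedLieHoms

variable {k : Type*} [CommRing k] {L L' : ℕ → Type*}
    [∀ n, AddCommGroup (L n)] [∀ n, Module k (L n)] [GradedLie k L]
    [∀ n, AddCommGroup (L' n)] [∀ n, Module k (L' n)] [GradedLie k L']

omit [GradedLie k L] in
theorem GradedLie.DSum.of_injective (n : ℕ) : Function.Injective (GradedLie.DSum.of k L n) :=
  fun x y h => by
    rw [← GradedLie.DSum.comp_of_same (k := k) n x, h, GradedLie.DSum.comp_of_same]

theorem GradedLieHom.comp_map (f : GradedLieHom k L L') (n : ℕ) (x : GradedLie.DSum k L) :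
    GradedLie.DSum.of k L' n (GradedLie.DSum.comp k L' n (f.toLieHom x)) =
      f.toLieHom (GradedLie.DSum.of k L n (GradedLie.DSum.comp k L n x)) := by
  induction x using GradedLie.DSum.induction with
  | h0 => simp
  | hadd x y hx hy => simp only [map_add, hx, hy]
  | hof m x =>
    obtain ⟨y, hy⟩ := f.map_degree m x
    by_cases h : m = n
    · subst h
      rw [hy, GradedLie.DSum.comp_of_same, GradedLie.DSum.comp_of_same, hy]
    · rw [hy, GradedLie.DSum.comp_of_ne h, GradedLie.DSum.comp_of_ne h, map_zero, map_zero,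
        map_zero]

theorem GradedLieHom.ext_toLieHom {f g : GradedLieHom k L L'}
    (h : ∀ x, f.toLieHom x = g.toLieHom x) : f = g := by
  cases f
  cases g
  congr 1
  exact LieHom.ext h

/-- The underlying morphism of an isomorphism of graded Lie algebras. -/
def GradedLieEquiv.toGradedLieHom (e : GradedLieEquiv k L L') : GradedLieHom k L L' where
  toLieHom := e.toLieEquiv.toLieHom
  map_degree := e.map_degree

/-- The isomorphism commutes with taking components, so a preimage of a homogeneous element and its
degree `n` component have the same image, and injectivity makes them equal. -/
theorem GradedLieEquiv.symm_map_degree (e : GradedLieEquiv k L L') (n : ℕ) (y : L' n) :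
    ∃ x : L n, e.toLieEquiv.symm (GradedLie.DSum.of k L' n y) = GradedLie.DSum.of k L n x := by
  refine ⟨GradedLie.DSum.comp k L n (e.toLieEquiv.symm (GradedLie.DSum.of k L' n y)), ?_⟩
  have h := e.toGradedLieHom.comp_map n (e.toLieEquiv.symm (GradedLie.DSum.of k L' n y))
  change GradedLie.DSum.of k L' n (GradedLie.DSum.comp k L' n (e.toLieEquiv _)) =
    e.toLieEquiv _ at h
  rw [LieEquiv.apply_symm_apply, GradedLie.DSum.comp_of_same] at h
  exact (congrArg e.toLieEquiv.symm h).trans (e.toLieEquiv.symm_apply_apply _)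

/-- The inverse of an isomorphism of graded Lie algebras. -/
def GradedLieEquiv.symm (e : GradedLieEquiv k L L') : GradedLieEquiv k L' L where
  toLieEquiv := e.toLieEquiv.symm
  map_degree := e.symm_map_degree

theorem GradedLieEquiv.finrank_eq (e : GradedLieEquiv k L L') (n : ℕ) :
    Module.finrank k (L n) = Module.finrank k (L' n) := by
  let f : L n →ₗ[k] L' n := GradedLie.DSum.comp k L' n ∘ₗ
    (e.toLieEquiv : GradedLie.DSum k L →ₗ⁅k⁆ GradedLie.DSum k L').toLinearMap ∘ₗ
      GradedLie.DSum.of k L n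
  have hf : ∀ x, GradedLie.DSum.of k L' n (f x) = e.toLieEquiv (GradedLie.DSum.of k L n x) :=
    fun x => by
      have h := e.toGradedLieHom.comp_map n (GradedLie.DSum.of k L n x)
      rw [GradedLie.DSum.comp_of_same] at h
      exact h
  refine LinearEquiv.finrank_eq (LinearEquiv.ofBijective f ⟨fun x y hxy => ?_, fun y => ?_⟩)
  · have h := congrArg (GradedLie.DSum.of k L' n) hxy
    rw [hf, hf] at h
    exact GradedLie.DSum.of_injective n (e.toLieEquiv.injective h)
  · obtain ⟨x, hx⟩ := e.symm_map_degree n y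
    refine ⟨x, GradedLie.DSum.of_injective (k := k) n ?_⟩
    rw [hf, ← hx, LieEquiv.apply_symm_apply]

theorem GradedLieHom.surjective_of_pieces (p : GradedLieHom k L L')
    (hp : ∀ n (y : L' n), ∃ x : L n,
      p.toLieHom (GradedLie.DSum.of k L n x) = GradedLie.DSum.of k L' n y) :
    Function.Surjective p.toLieHom := fun y => by
  induction y using GradedLie.DSum.induction with
  | h0 => exact ⟨0, map_zero _⟩
  | hadd x y hx hy =>
    obtain ⟨x', rfl⟩ := hx
    obtain ⟨y', rfl⟩ := hy
    exact ⟨x' + y', map_add _ _ _⟩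
  | hof n y =>
    obtain ⟨x, hx⟩ := hp n y
    exact ⟨_, hx⟩

/-- A morphism of graded Lie algebras factors uniquely through a surjective morphism whose kernel
it contains in its own. -/
theorem GradedLieHom.existsUnique_factor {M : ℕ → Type*}
    [∀ n, AddCommGroup (M n)] [∀ n, Module k (M n)] [GradedLie k M]
    (p : GradedLieHom k L M) (f : GradedLieHom k L L')
    (hp : ∀ n (y : M n), ∃ x : L n,
      p.toLieHom (GradedLie.DSum.of k L n x) = GradedLie.DSum.of k M n y)
    (hker : ∀ x, p.toLieHom x = 0 → f.toLieHom x = 0) :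
    ∃! g : GradedLieHom k M L', ∀ x, g.toLieHom (p.toLieHom x) = f.toLieHom x := by
  have hsurj := p.surjective_of_pieces hp
  let P : GradedLie.DSum k L →ₗ[k] GradedLie.DSum k M := p.toLieHom.toLinearMap
  let F : GradedLie.DSum k L →ₗ[k] GradedLie.DSum k L' := f.toLieHom.toLinearMap
  have hPF : LinearMap.ker P ≤ LinearMap.ker F := fun x hx => hker x hx
  let g : GradedLie.DSum k M →ₗ[k] GradedLie.DSum k L' :=
    (LinearMap.ker P).liftQ F hPF ∘ₗ
      (P.quotKerEquivOfSurjective hsurj).symm.toLinearMap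
  have hg : ∀ x, g (p.toLieHom x) = f.toLieHom x := fun x => by
    have h : (P.quotKerEquivOfSurjective hsurj).symm (P x) = (LinearMap.ker P).mkQ x := by
      rw [LinearEquiv.symm_apply_eq]
      rfl
    change (LinearMap.ker P).liftQ F hPF ((P.quotKerEquivOfSurjective hsurj).symm (P x)) = _
    rw [h]
    rfl
  refine ⟨{ g with
    map_lie' := ?_
    map_degree := ?_ }, hg, fun g' hg' => GradedLieHom.ext_toLieHom fun y => ?_⟩
  · intro y z
    obtain ⟨x, rfl⟩ := hsurj y
    obtain ⟨w, rfl⟩ := hsurj z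
    change g ⁅p.toLieHom x, p.toLieHom w⁆ = ⁅g (p.toLieHom x), g (p.toLieHom w)⁆
    rw [← LieHom.map_lie, hg, hg, hg, LieHom.map_lie]
  · intro n y
    obtain ⟨x, hx⟩ := hp n y
    obtain ⟨z, hz⟩ := f.map_degree n x
    refine ⟨z, ?_⟩
    change g (GradedLie.DSum.of k M n y) = _
    rw [← hx, hg, hz]
  · obtain ⟨x, rfl⟩ := hsurj y
    exact (hg' x).trans (hg x).symm

end GradedLieHoms

/-! ### The kernel of the projection to the Chen Lie algebra. -/

section ChenLieAlgebras

open scoped commutatorElement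

variable {k : Type*} [Field k] {G : Type*} [Group G]

theorem map_lcsTerm_mk' (N : Subgroup G) [N.Normal] (n : ℕ) :
    (lcsTerm G n).map (QuotientGroup.mk' N) = lcsTerm (G ⧸ N) n := by
  rw [lcsTerm, Subgroup.map_lowerCentralSeries,
    Subgroup.map_top_of_surjective _ (QuotientGroup.mk'_surjective N)]
  rfl

theorem chenProj_of (i n : ℕ) (x : GrPiece k G n) :
    (chenProj k G i).toLieHom (GradedLie.DSum.of k (GrPiece k G) n x) =
      GradedLie.DSum.of k (ChenPiece k G i) n
        (GrPiece.map k (QuotientGroup.mk' (derivedSeries G i)) n x) :=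
  DirectSum.toModule_lof k (φ := fun n => GradedLie.DSum.of k (ChenPiece k G i) n ∘ₗ
    GrPiece.map k (QuotientGroup.mk' (derivedSeries G i)) n) n x

theorem LCSQuot.map_mk'_surjective (N : Subgroup G) [N.Normal] (n : ℕ) :
    Function.Surjective (LCSQuot.map (QuotientGroup.mk' N) n) := fun y => by
  obtain ⟨⟨h, hh⟩, rfl⟩ := LCSQuot.proj_surjective n y
  have hh' := hh
  rw [← map_lcsTerm_mk'] at hh'
  obtain ⟨g, hg, rfl⟩ := hh'
  exact ⟨LCSQuot.mk n g hg, rfl⟩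

/-- If `g` becomes trivial, then its image lies in `Γₙ₊₁(G/N)`, which is the image of `Γₙ₊₁G`.
Dividing `g` by a lift `h ∈ Γₙ₊₁G` lands in `N` without changing the class. -/
theorem LCSQuot.exists_mem_of_map_mk'_eq_one {N : Subgroup G} [N.Normal] {n : ℕ}
    {x : LCSQuot G n} (hx : LCSQuot.map (QuotientGroup.mk' N) n x = 1) :
    ∃ (g : G) (hg : g ∈ lcsTerm G n), g ∈ N ∧ LCSQuot.mk n g hg = x := by
  obtain ⟨⟨g, hg⟩, rfl⟩ := LCSQuot.proj_surjective n x
  have h : QuotientGroup.mk' N g ∈ lcsTerm (G ⧸ N) (n + 1) :=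
    (LCSQuot.mk_eq_one (map_mem_lcsTerm _ hg)).1 hx
  rw [← map_lcsTerm_mk'] at h
  obtain ⟨h, hh, hhg⟩ := h
  have hh' : h ∈ lcsTerm G n := lcsTerm_antitone G (Nat.le_succ n) hh
  refine ⟨h⁻¹ * g, mul_mem (inv_mem hh') hg, QuotientGroup.eq.1 hhg, ?_⟩
  refine (LCSQuot.mk_eq_mk _ hg).2 ?_
  have : (h⁻¹ * g)⁻¹ * g = g⁻¹ * h * g⁻¹⁻¹ := by group
  rw [this]
  exact Subgroup.Normal.conj_mem inferInstance h hh g⁻¹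

theorem GrPiece.map_mk'_surjective (N : Subgroup G) [N.Normal] (n : ℕ) :
    Function.Surjective (GrPiece.map k (QuotientGroup.mk' N) n) :=
  LinearMap.lTensor_surjective k
    (g := (MonoidHom.toAdditive (LCSQuot.map (QuotientGroup.mk' N) n)).toIntLinearMap)
    (LCSQuot.map_mk'_surjective N n)

/-- The kernel of `grₙ(G; k) → grₙ(G/N; k)` is spanned by the classes of elements of `N`. -/
theorem GrPiece.mem_span_of_map_mk'_eq_zero {N : Subgroup G} [N.Normal] {n : ℕ}
    {x : GrPiece k G n} (hx : GrPiece.map k (QuotientGroup.mk' N) n x = 0) :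
    x ∈ Submodule.span k {y | ∃ (g : G) (hg : g ∈ lcsTerm G n), g ∈ N ∧
      y = GrPiece.cls k n g hg} := by
  let f := (MonoidHom.toAdditive (LCSQuot.map (QuotientGroup.mk' N) n)).toIntLinearMap
  have hex : Function.Exact (LinearMap.ker f).subtype f := fun y => by
    rw [← LinearMap.mem_ker]
    simp
  have hf : Function.Surjective f := LCSQuot.map_mk'_surjective N n
  -- By right exactness of the tensor product, the kernel after extending scalars comes from the
  -- kernel over the integers.
  obtain ⟨w, rfl⟩ := (lTensor_exact k hex hf x).1 hx
  induction w using TensorProduct.induction_on with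
  | zero => rw [map_zero]; exact zero_mem _
  | add w w' hw hw' =>
    have hz : ∀ v, GrPiece.map k (QuotientGroup.mk' N) n
        (LinearMap.lTensor k (LinearMap.ker f).subtype v) = 0 := fun v =>
      (lTensor_exact k hex hf _).2 ⟨v, rfl⟩
    rw [map_add]
    exact add_mem (hw (hz w)) (hw' (hz w'))
  | tmul s y =>
    obtain ⟨y, hy⟩ := y
    obtain ⟨g, hg, hgN, hgy⟩ := LCSQuot.exists_mem_of_map_mk'_eq_one (x := y.toMul) hy
    have e : LinearMap.lTensor k (LinearMap.ker f).subtype (s ⊗ₜ ⟨y, hy⟩) =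
        s • GrPiece.cls k n g hg := by
      rw [LinearMap.lTensor_tmul, GrPiece.cls, TensorProduct.smul_tmul', smul_eq_mul, mul_one, hgy]
      rfl
    rw [e]
    exact Submodule.smul_mem _ s (Submodule.subset_span ⟨g, hg, hgN, rfl⟩)

variable (k G) in
/-- The span in `grₙ(G; k)` of the classes of elements of the derived series of `G`. -/
def GrPiece.derivedSpan (j n : ℕ) : Submodule k (GrPiece k G n) :=
  Submodule.span k {y | ∃ (g : G) (hg : g ∈ lcsTerm G n), g ∈ derivedSeries G j ∧
    y = GrPiece.cls k n g hg}

theorem GrPiece.br_mem_derivedSpan {j a b : ℕ} {x : GrPiece k G a} {y : GrPiece k G b}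
    (hx : x ∈ GrPiece.derivedSpan k G j a) (hy : y ∈ GrPiece.derivedSpan k G j b) :
    GrPiece.br k G a b x y ∈ GrPiece.derivedSpan k G (j + 1) (a + b) := by
  induction hx using Submodule.span_induction with
  | zero => simp
  | add x x' _ _ hx hx' => rw [map_add, LinearMap.add_apply]; exact add_mem hx hx'
  | smul c x _ hx => rw [map_smul, LinearMap.smul_apply]; exact Submodule.smul_mem _ c hx
  | mem x hx =>
    obtain ⟨g, hg, hgj, rfl⟩ := hx
    induction hy using Submodule.span_induction with
    | zero => simp
    | add y y' _ _ hy hy' => rw [map_add]; exact add_mem hy hy'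
    | smul c y _ hy => rw [map_smul]; exact Submodule.smul_mem _ c hy
    | mem y hy =>
      obtain ⟨h, hh, hhj, rfl⟩ := hy
      refine Submodule.subset_span ⟨⁅g, h⁆, commutator_mem_lcsTerm le_rfl hg hh, ?_, ?_⟩
      · rw [derivedSeries_succ]
        exact Subgroup.commutator_mem_commutator hgj hhj
      · rw [GrPiece.cls, GrPiece.cls, GrPiece.br_tmul, mul_one, GrPiece.cls]

/-- The easy inclusion, valid for every group: brackets of classes are classes of commutators, and
the group commutator advances the derived series of `G` by one. -/
theorem comp_mem_derivedSpan {j : ℕ} {x : Gr k G}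
    (hx : x ∈ GradedLie.derivedTerm k (GrPiece k G) j) (n : ℕ) :
    GradedLie.DSum.comp k (GrPiece k G) n x ∈ GrPiece.derivedSpan k G j n := by
  induction j generalizing x n with
  | zero =>
    induction GradedLie.DSum.comp k (GrPiece k G) n x using GrPiece.induction with
    | h0 => exact zero_mem _
    | hadd x y hx hy => exact add_mem hx hy
    | htmul s g hg =>
      have e : s ⊗ₜ Additive.ofMul (LCSQuot.mk n g hg) = s • GrPiece.cls k n g hg := by
        rw [GrPiece.cls, TensorProduct.smul_tmul', smul_eq_mul, mul_one]
      rw [e]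
      exact Submodule.smul_mem _ s (Submodule.subset_span ⟨g, hg, Subgroup.mem_top g, rfl⟩)
  | succ j ih =>
    induction hx using Submodule.span_induction with
    | zero => rw [map_zero]; exact zero_mem _
    | add x y _ _ hx hy => rw [map_add]; exact add_mem hx hy
    | smul c x _ hx => rw [map_smul]; exact Submodule.smul_mem _ c hx
    | mem z hz =>
      obtain ⟨a, b, x, y, hx, hy, rfl⟩ := hz
      have hx' := ih hx a
      have hy' := ih hy b
      rw [GradedLie.DSum.comp_of_same] at hx' hy'
      rw [GradedLie.DSum.lie_of_of]
      by_cases h : a + b = n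
      · subst h
        rw [GradedLie.DSum.comp_of_same]
        exact GrPiece.br_mem_derivedSpan hx' hy'
      · rw [GradedLie.DSum.comp_of_ne h]
        exact zero_mem _

theorem chenProj_eq_zero_of_mem_derivedTerm {i : ℕ} {x : Gr k G}
    (hx : x ∈ GradedLie.derivedTerm k (GrPiece k G) i) : (chenProj k G i).toLieHom x = 0 := by
  have hmap : ∀ n, ∀ y ∈ GrPiece.derivedSpan k G i n,
      GrPiece.map k (QuotientGroup.mk' (derivedSeries G i)) n y = 0 := fun n y hy => by
    induction hy using Submodule.span_induction with
    | zero => exact map_zero _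
    | add x y _ _ hx hy => rw [map_add, hx, hy, add_zero]
    | smul c x _ hx => rw [map_smul, hx, smul_zero]
    | mem z hz =>
      obtain ⟨g, hg, hgi, rfl⟩ := hz
      rw [GrPiece.cls, GrPiece.map_tmul, (LCSQuot.mk_eq_one _).2, ofMul_one,
        TensorProduct.tmul_zero]
      have : QuotientGroup.mk' (derivedSeries G i) g = 1 := (QuotientGroup.eq_one_iff g).2 hgi
      rw [this]
      exact one_mem _
  obtain ⟨s, hs⟩ := GradedLie.DSum.eq_sum x
  rw [hs, map_sum]
  refine Finset.sum_eq_zero fun n _ => ?_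
  rw [chenProj_of, hmap n _ (comp_mem_derivedSpan hx n), map_zero]

/-- The inclusion that needs formality: in each degree the kernel is spanned by classes of elements
of `G⁽ⁱ⁾`, and their logarithms place these classes in the derived term. -/
theorem IsFilteredFormal.mem_derivedTerm_of_chenProj_eq_zero [CharZero k]
    (hG : IsFilteredFormal k G) {i : ℕ} {x : Gr k G} (hx : (chenProj k G i).toLieHom x = 0) :
    x ∈ GradedLie.derivedTerm k (GrPiece k G) i := by
  obtain ⟨s, hs⟩ := GradedLie.DSum.eq_sum x
  rw [hs]
  refine sum_mem fun n _ => ?_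
  have h := (chenProj k G i).comp_map n x
  rw [hx, map_zero, map_zero, chenProj_of] at h
  have h0 := GradedLie.DSum.of_injective (k := k) n (h.symm.trans (map_zero _).symm)
  have hspan := GrPiece.mem_span_of_map_mk'_eq_zero h0
  generalize GradedLie.DSum.comp k (GrPiece k G) n x = v at hspan
  induction hspan using Submodule.span_induction with
  | zero => rw [map_zero]; exact zero_mem _
  | add x y _ _ hx hy => rw [map_add]; exact add_mem hx hy
  | smul c x _ hx => rw [map_smul]; exact Submodule.smul_mem _ c hx
  | mem z hz =>
    obtain ⟨g, hg, hgi, rfl⟩ := hz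
    exact hG.of_cls_mem_derivedTerm hg hgi

theorem chenProj_exists_of (i n : ℕ) (y : ChenPiece k G i n) : ∃ x : GrPiece k G n,
    (chenProj k G i).toLieHom (GradedLie.DSum.of k (GrPiece k G) n x) =
      GradedLie.DSum.of k (ChenPiece k G i) n y := by
  obtain ⟨x, rfl⟩ := GrPiece.map_mk'_surjective (derivedSeries G i) n y
  exact ⟨x, chenProj_of i n x⟩

theorem chenProj_surjective (i : ℕ) : Function.Surjective (chenProj k G i).toLieHom :=
  (chenProj k G i).surjective_of_pieces (chenProj_exists_of i)

variable [CharZero k] {G₁ G₂ : Type*} [Group G₁] [Group G₂]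

/-- The kernel of the first projection lies in the derived term of `gr(G₁; k)`, which `α` maps into
that of `gr(G₂; k)`, which the second projection kills. So the composite factors. -/
theorem IsFilteredFormal.existsUnique_chenMap (h₁ : IsFilteredFormal k G₁)
    (α : GradedLieHom k (GrPiece k G₁) (GrPiece k G₂)) (i : ℕ) :
    ∃! αi : GradedLieHom k (ChenPiece k G₁ i) (ChenPiece k G₂ i),
      ∀ x : Gr k G₁, αi.toLieHom ((chenProj k G₁ i).toLieHom x) =
        (chenProj k G₂ i).toLieHom (α.toLieHom x) := by
  let f : GradedLieHom k (GrPiece k G₁) (ChenPiece k G₂ i) :=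
    { (chenProj k G₂ i).toLieHom.comp α.toLieHom with
      map_degree := fun n x => by
        obtain ⟨y, hy⟩ := α.map_degree n x
        obtain ⟨z, hz⟩ := (chenProj k G₂ i).map_degree n y
        refine ⟨z, ?_⟩
        change (chenProj k G₂ i).toLieHom (α.toLieHom _) = _
        rw [hy, hz] }
  exact GradedLieHom.existsUnique_factor (chenProj k G₁ i) f (chenProj_exists_of i) fun x hx =>
    chenProj_eq_zero_of_mem_derivedTerm
      (GradedLie.map_mem_derivedTerm α.toLieHom (h₁.mem_derivedTerm_of_chenProj_eq_zero hx))

/-- The maps induced by `e` and by its inverse are mutually inverse after composing with the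
projections, hence outright, since the projections are surjective. -/
theorem IsFilteredFormal.nonempty_chenEquiv (h₁ : IsFilteredFormal k G₁)
    (h₂ : IsFilteredFormal k G₂) (e : GradedLieEquiv k (GrPiece k G₁) (GrPiece k G₂)) (i : ℕ) :
    Nonempty (GradedLieEquiv k (ChenPiece k G₁ i) (ChenPiece k G₂ i)) := by
  obtain ⟨a, ha, -⟩ := h₁.existsUnique_chenMap e.toGradedLieHom i
  obtain ⟨b, hb, -⟩ := h₂.existsUnique_chenMap e.symm.toGradedLieHom i
  refine ⟨{ a.toLieHom with
    invFun := b.toLieHom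
    left_inv := fun y => ?_
    right_inv := fun y => ?_
    map_degree := a.map_degree }⟩
  · obtain ⟨x, rfl⟩ := chenProj_surjective (k := k) i y
    change b.toLieHom (a.toLieHom _) = _
    rw [ha, hb]
    exact congrArg _ (e.toLieEquiv.symm_apply_apply x)
  · obtain ⟨x, rfl⟩ := chenProj_surjective (k := k) i y
    change a.toLieHom (b.toLieHom _) = _
    rw [hb, ha]
    exact congrArg _ (e.toLieEquiv.apply_symm_apply x)

end ChenLieAlgebras

end

/-! ### The three assertions of the theorem. -/

theorem theorem4p6 {k : Type*} [Field k] [CharZero k] {G₁ G₂ : Type*} [Group G₁] [Group G₂]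
    [Group.FG G₁] [Group.FG G₂] (h₁ : IsFilteredFormal k G₁) (h₂ : IsFilteredFormal k G₂) :
    (∀ (α : GradedLieHom k (GrPiece k G₁) (GrPiece k G₂)) (i : ℕ), 1 ≤ i →
      ∃! αi : GradedLieHom k (ChenPiece k G₁ i) (ChenPiece k G₂ i),
        ∀ x : Gr k G₁, αi.toLieHom ((chenProj k G₁ i).toLieHom x) =
          (chenProj k G₂ i).toLieHom (α.toLieHom x)) ∧
    (Nonempty (GradedLieEquiv k (GrPiece k G₁) (GrPiece k G₂)) → ∀ i : ℕ, 1 ≤ i →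
      Nonempty (GradedLieEquiv k (ChenPiece k G₁ i) (ChenPiece k G₂ i))) ∧
    ((∃ n : ℕ, 1 ≤ n ∧ chenRank k G₁ n ≠ chenRank k G₂ n) →
      ¬ Nonempty (GradedLieEquiv k (GrPiece k G₁) (GrPiece k G₂))) := by
  refine ⟨fun α i _ => h₁.existsUnique_chenMap α i, fun ⟨e⟩ i _ => h₁.nonempty_chenEquiv h₂ e i, ?_⟩
  rintro ⟨n, -, hn⟩ ⟨e⟩
  obtain ⟨e₂⟩ := h₁.nonempty_chenEquiv h₂ e 2
  exact hn (e₂.finrank_eq n)
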